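/- Let $K$ be a commutative ring and $t\in K$. Let $\Lambda$ be the ring of symmetric formal power series of bounded degree in $x_1,x_2,\dots$ over $K$, and $\widehat\Lambda$ its completion (symmetric formal power series of arbitrary degree). Let $(\,,)\colon\widehat\Lambda\times\Lambda\to K$ be the Hall inner product, i.e. $\big(\sum_\lambda A_\lambda s_\lambda,\sum_\lambda B_\lambda s_\lambda\big)=\sum_\lambda A_\lambda B_\lambda$, where $s_\lambda$ are the Schur functions. For $F\in\widehat\Lambda$ let $F^\perp\colon\Lambda\to\Lambda$ be the map $F^\perp=((F,-)\otimes\mathrm{id})\circ\Delta$, where $\Delta f=f(x,y)$; that is, $F^\perp(f)=\sum (F,f_1)f_2$ if $f(x,y)=\sum f_1(x)f_2(y)$. Put $E(t)=\sum_{i\ge 0}t^ie_i\in\widehat\Lambda$. For partitions $\mu\subset\lambda$ let $g_{\lambda/\mu}=\sum_T x^T$ be the dual stable Grothendieck polynomial, where $T$ runs over the reverse plane partitions of shape $\lambda/\mu$ (fillings by positive integers weakly increasing along rows and columns) and the exponent of $x_i$ in $x^T$ is the number of columns of $T$ containing $i$; put $g_\lambda=g_{\lambda/\emptyset}$. Let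 $|\lambda/\mu|$ be the number of boxes and $c(\lambda/\mu)$ the number of (nonempty) columns of $\lambda/\mu$; $\lambda/\mu$ is a vertical strip if it has at most one box in each row. Then $E(t)^\perp$ is a $K$-algebra automorphism of $\Lambda$. For all partitions $\mu\subset\lambda$ one has $g_{\lambda/\mu}\in\Lambda$ and $$E(t)^\perp(g_{\lambda/\mu})=\sum_{\substack{\mu\subset\nu\subset\lambda\\ \lambda/\nu\text{ vertical strip}}}t^{c(\lambda/\nu)}(t+1)^{|\lambda/\nu|-c(\lambda/\nu)}\,g_{\nu/\mu}=\sum_{\substack{\mu\subset\nu\subset\lambda\\ \nu/\mu\text{ vertical strip}}}t^{c(\nu/\mu)}(t+1)^{|\nu/\mu|-c(\nu/\mu)}\,g_{\lambda/\nu}.$$ In particular, for every partition $\lambda$ with $\ell(\lambda)$ parts, $$E(t)^\perp(g_\lambda)=\sum_{\substack{\nu\subset\lambda\\ \lambda/\nu\text{ vertical strip}}}t^{c(\lambda/\nu)}(t+1)^{|\lambda/\nu|-c(\lambda/\nu)}\,g_\nu=g_\lambda+\sum_{k=1}^{\ell(\lambda)}t(t+1)^{k-1}g_{\lambda/(1^k)},$$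 where the last sum is empty for $\lambda=\emptyset$. -/

import Mathlib

namespace DualGrothendieck

noncomputable section

/-! ### Symmetric functions in the variables `x 0, x 1, x 2, …` -/

/-- `Λ̂`: the symmetric formal power series (of possibly unbounded degree). -/
def SymSeries (K : Type*) [CommRing K] : Subalgebra K (MvPowerSeries ℕ K) :=
  ⨅ σ : Equiv.Perm ℕ,
    AlgHom.equalizer (MvPowerSeries.renameEquiv K σ : MvPowerSeries ℕ K →ₐ[K] MvPowerSeries ℕ K)
      (AlgHom.id K _)

/-- The formal power series of bounded degree. -/
def BoundedSeries (K : Type*) [CommRing K] : Subalgebra K (MvPowerSeries ℕ K) where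
  carrier := {F | ∃ N : ℕ, ∀ α : ℕ →₀ ℕ, MvPowerSeries.coeff α F ≠ 0 → α.degree ≤ N}
  mul_mem' := by
    classical
    rintro F G ⟨M, hM⟩ ⟨N, hN⟩
    refine ⟨M + N, fun α h => ?_⟩
    rw [MvPowerSeries.coeff_mul] at h
    obtain ⟨p, hp, hne⟩ := Finset.exists_ne_zero_of_sum_ne_zero h
    rw [Finset.HasAntidiagonal.mem_antidiagonal] at hp
    have h1 := hM p.1 (left_ne_zero_of_mul hne)
    have h2 := hN p.2 (right_ne_zero_of_mul hne)
    rw [← hp, map_add]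
    omega
  add_mem' := by
    rintro F G ⟨M, hM⟩ ⟨N, hN⟩
    refine ⟨max M N, fun α h => ?_⟩
    by_contra hlt
    rw [not_le, max_lt_iff] at hlt
    apply h
    have h1 : MvPowerSeries.coeff α F = 0 := by
      by_contra h'
      exact absurd (hM α h') (by omega)
    have h2 : MvPowerSeries.coeff α G = 0 := by
      by_contra h'
      exact absurd (hN α h') (by omega)
    rw [map_add, h1, h2, add_zero]
  algebraMap_mem' := by
    classical
    intro r
    refine ⟨0, fun α h => ?_⟩
    rw [MvPowerSeries.algebraMap_apply, MvPowerSeries.coeff_C] at h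
    have : α = 0 := by
      by_contra h'
      exact h (if_neg h')
    simp [this]

/-- `Λ`: the symmetric formal power series of bounded degree. -/
def SymFun (K : Type*) [CommRing K] : Subalgebra K (MvPowerSeries ℕ K) :=
  SymSeries K ⊓ BoundedSeries K

section Lemmas

variable {K : Type*} [CommRing K]

theorem coeff_renameEquiv {ι κ : Type*} (σ : ι ≃ κ) (F : MvPowerSeries ι K) (α : ι →₀ ℕ) :
    MvPowerSeries.coeff (α.mapDomain σ) (MvPowerSeries.renameEquiv K σ F) =
      MvPowerSeries.coeff α F := by
  have h := MvPowerSeries.coeff_embDomain_rename (R := K) σ.toEmbedding F α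
  rw [Finsupp.embDomain_eq_mapDomain] at h
  exact h

theorem mem_symSeries_iff {F : MvPowerSeries ℕ K} :
    F ∈ SymSeries K ↔ ∀ (σ : Equiv.Perm ℕ) (α : ℕ →₀ ℕ),
      MvPowerSeries.coeff (α.mapDomain σ) F = MvPowerSeries.coeff α F := by
  simp only [SymSeries, Algebra.mem_iInf, AlgHom.mem_equalizer]
  refine forall_congr' fun σ => ?_
  constructor
  · intro h α
    have h' : MvPowerSeries.renameEquiv K σ F = F := h
    conv_lhs => rw [← h']
    exact coeff_renameEquiv σ F α
  · intro h
    change MvPowerSeries.renameEquiv K σ F = F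
    ext α
    have hα : (α.mapDomain σ.symm).mapDomain σ = α := by
      rw [← Finsupp.mapDomain_comp]
      simp
    rw [← hα, coeff_renameEquiv, h]

end Lemmas

/-! ### Schur functions and the Hall inner product -/

/-- The exponent vector of the monomial `x^T` of a semistandard tableau `T`. -/
def tableauWeight {lam : YoungDiagram} (T : SemistandardYoungTableau lam) : ℕ →₀ ℕ :=
  ∑ c ∈ lam.cells, Finsupp.single (T c.1 c.2) 1

/-- The Schur function `s_λ = ∑_T x^T`, summed over the semistandard tableaux of shape `λ`. -/
def schur (K : Type*) [CommRing K] (lam : YoungDiagram) : MvPowerSeries ℕ K :=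
  fun α => (Nat.card {T : SemistandardYoungTableau lam // tableauWeight T = α} : K)

variable {K : Type*} [CommRing K]

/-- `F = ∑_λ A_λ s_λ`, possibly an infinite sum. In every degree only finitely many `λ`
contribute, so each coefficient of the right hand side is a finite sum. -/
def IsSchurExpansion (F : MvPowerSeries ℕ K) (A : YoungDiagram → K) : Prop :=
  ∀ α : ℕ →₀ ℕ, MvPowerSeries.coeff α F =
    ∑ᶠ lam : YoungDiagram, A lam * MvPowerSeries.coeff α (schur K lam)

open Classical in
/-- The coefficients of the Schur expansion of `F`. Every symmetric series has
exactly one such expansion; the value `0` is used for series without one. -/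
def schurCoeff (F : MvPowerSeries ℕ K) : YoungDiagram → K :=
  if h : ∃! A : YoungDiagram → K, IsSchurExpansion F A then h.choose else 0

theorem schurCoeff_zero : schurCoeff (0 : MvPowerSeries ℕ K) = 0 := by
  unfold schurCoeff
  split_ifs with h
  · refine (h.choose_spec.2 0 fun α => ?_).symm
    simp
  · rfl

/-- The Hall inner product `( , ) : Λ̂ × Λ → K`, for which the Schur functions are orthonormal:
`(∑ A_λ s_λ, ∑ B_λ s_λ) = ∑ A_λ B_λ`, where only finitely many `B_λ` are nonzero. -/
def hall (F : SymSeries K) (f : SymFun K) : K :=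
  ∑ᶠ lam : YoungDiagram,
    schurCoeff (F : MvPowerSeries ℕ K) lam * schurCoeff (f : MvPowerSeries ℕ K) lam

theorem hall_zero (F : SymSeries K) : hall F 0 = 0 := by
  simp [hall, schurCoeff_zero]

/-! ### The maps `F^⊥` -/

/-- `f(x, y)`: the series `f` in the two alphabets `x 0, x 1, …` (indices `Sum.inl i`) and
`y 0, y 1, …` (indices `Sum.inr i`). For symmetric `f` the chosen bijection
`ℕ ≃ ℕ ⊕ ℕ` does not matter. -/
def twoAlphabets (f : MvPowerSeries ℕ K) : MvPowerSeries (ℕ ⊕ ℕ) K :=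
  MvPowerSeries.renameEquiv K Equiv.natSumNatEquivNat.symm f

/-- The coefficient of `y^β` in `f(x, y)`, as a series in `x`. -/
def yCoeff (f : MvPowerSeries ℕ K) (β : ℕ →₀ ℕ) : MvPowerSeries ℕ K :=
  fun α => MvPowerSeries.coeff (Finsupp.sumElim α β) (twoAlphabets f)

theorem coeff_yCoeff (f : MvPowerSeries ℕ K) (α β : ℕ →₀ ℕ) :
    MvPowerSeries.coeff α (yCoeff f β) =
      MvPowerSeries.coeff ((Finsupp.sumElim α β).mapDomain Equiv.natSumNatEquivNat) f := by
  change MvPowerSeries.coeff (Finsupp.sumElim α β) (twoAlphabets f) = _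
  rw [twoAlphabets, ← coeff_renameEquiv Equiv.natSumNatEquivNat.symm f,
    ← Finsupp.mapDomain_comp, Equiv.symm_comp_self, Finsupp.mapDomain_id]

theorem coeff_yCoeff_perm {f : MvPowerSeries ℕ K} (hf : f ∈ SymSeries K)
    (σ τ : Equiv.Perm ℕ) (α β : ℕ →₀ ℕ) :
    MvPowerSeries.coeff (α.mapDomain σ) (yCoeff f (β.mapDomain τ)) =
      MvPowerSeries.coeff α (yCoeff f β) := by
  rw [coeff_yCoeff, coeff_yCoeff]
  have h := mem_symSeries_iff.1 hf
    ((Equiv.natSumNatEquivNat.symm.trans (Equiv.sumCongr σ τ)).trans Equiv.natSumNatEquivNat)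
    ((Finsupp.sumElim α β).mapDomain Equiv.natSumNatEquivNat)
  rw [← h, ← Finsupp.mapDomain_comp]
  have h' : (Finsupp.sumElim (α.mapDomain σ) (β.mapDomain τ)) =
      (Finsupp.sumElim α β).mapDomain (Equiv.sumCongr σ τ) := by
    simp only [Finsupp.sumElim_eq_add, Finsupp.mapDomain_add, ← Finsupp.mapDomain_comp]
    rfl
  rw [h', ← Finsupp.mapDomain_comp]
  congr 3
  funext i
  simp only [Function.comp_apply, Equiv.trans_apply, Equiv.symm_apply_apply]

theorem degree_sumElim (α β : ℕ →₀ ℕ) :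
    ((Finsupp.sumElim α β).mapDomain Equiv.natSumNatEquivNat).degree = α.degree + β.degree := by
  rw [Finsupp.degree_mapDomain, Finsupp.sumElim_eq_add, map_add, Finsupp.degree_mapDomain,
    Finsupp.degree_mapDomain]

theorem yCoeff_mem (f : SymFun K) (β : ℕ →₀ ℕ) :
    yCoeff (f : MvPowerSeries ℕ K) β ∈ SymFun K := by
  obtain ⟨f, hs, N, hN⟩ := f
  refine ⟨?_, N, fun α h => ?_⟩
  · rw [SetLike.mem_coe, mem_symSeries_iff]
    intro σ α
    have := coeff_yCoeff_perm hs σ 1 α β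
    simpa using this
  · rw [coeff_yCoeff] at h
    have := hN _ h
    rw [degree_sumElim] at this
    omega

/-- The result of applying `(F, -)` to `f(x, y)` in the variables `x`: the series `∑_β (F, [y^β] f(x, y)) y^β`. -/
def perpSeries (F : SymSeries K) (f : SymFun K) : MvPowerSeries ℕ K :=
  fun β => hall F ⟨yCoeff (f : MvPowerSeries ℕ K) β, yCoeff_mem f β⟩

theorem perpSeries_mem (F : SymSeries K) (f : SymFun K) : perpSeries F f ∈ SymFun K := by
  have hs := f.2.1
  obtain ⟨N, hN⟩ := f.2.2
  refine ⟨?_, N, fun β h => ?_⟩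
  · rw [SetLike.mem_coe, mem_symSeries_iff]
    intro τ β
    change hall F _ = hall F _
    congr 2
    ext α
    have := coeff_yCoeff_perm hs 1 τ α β
    simpa using this
  · by_contra hlt
    apply h
    change hall F _ = 0
    rw [← hall_zero F]
    congr 1
    apply Subtype.ext
    ext α
    change MvPowerSeries.coeff α (yCoeff _ β) = 0
    rw [coeff_yCoeff]
    by_contra h'
    have := hN _ h'
    rw [degree_sumElim] at this
    omega

/-- `F^⊥ = ((F, -) ⊗ id) ∘ Δ : Λ → Λ`, where `Δ f = f(x, y)`. Expanding
`f(x, y) = ∑ f₁(x) f₂(y)` in powers of `y` shows that `∑ (F, f₁) f₂(y)` is obtained by applying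
`(F, -)` to the coefficient, in `Λ(x)`, of each monomial `y^β` of `f(x, y)`. -/
def perp (F : SymSeries K) (f : SymFun K) : SymFun K :=
  ⟨perpSeries F f, perpSeries_mem F f⟩

/-! ### The series `E(t)` -/

/-- The elementary symmetric function `e_i`: the sum of all squarefree monomials of degree `i`. -/
def elemSym (K : Type*) [CommRing K] (i : ℕ) : MvPowerSeries ℕ K :=
  fun α => if α.degree = i ∧ ∀ j ∈ α.support, α j = 1 then 1 else 0

/-- `∑_{i ≥ 0} t^i e_i`. The coefficient of `x^α` in `e_i` vanishes for `i > |α|`. -/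
def ESeries (t : K) : MvPowerSeries ℕ K :=
  fun α => ∑ i ∈ Finset.range (α.degree + 1), t ^ i * MvPowerSeries.coeff α (elemSym K i)

theorem coeff_elemSym_perm (i : ℕ) (σ : Equiv.Perm ℕ) (α : ℕ →₀ ℕ) :
    MvPowerSeries.coeff (α.mapDomain σ) (elemSym K i) = MvPowerSeries.coeff α (elemSym K i) := by
  change (if _ then _ else _) = (if _ then _ else _)
  congr 1
  have hdeg : (α.mapDomain σ).degree = α.degree := Finsupp.degree_mapDomain _ _
  rw [hdeg, ← Finsupp.equivMapDomain_eq_mapDomain]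
  simp only [Finsupp.mem_support_iff, Finsupp.equivMapDomain_apply, eq_iff_iff]
  refine and_congr_right fun _ => ⟨fun h j hj => ?_, fun h j hj => h _ hj⟩
  have := h (σ j)
  simpa using this (by simpa using hj)

/-- `E(t) = ∑_{i ≥ 0} t^i e_i ∈ Λ̂`. -/
def E (t : K) : SymSeries K :=
  ⟨ESeries t, by
    rw [mem_symSeries_iff]
    intro σ α
    have hdeg : (α.mapDomain σ).degree = α.degree := Finsupp.degree_mapDomain _ _
    change ∑ i ∈ Finset.range ((α.mapDomain σ).degree + 1),
        t ^ i * MvPowerSeries.coeff (α.mapDomain σ) (elemSym K i) =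
      ∑ i ∈ Finset.range (α.degree + 1), t ^ i * MvPowerSeries.coeff α (elemSym K i)
    rw [hdeg]
    exact Finset.sum_congr rfl fun i _ => by rw [coeff_elemSym_perm]⟩

/-! ### Skew shapes and dual stable Grothendieck polynomials -/

/-- The boxes `(row, column)` of the skew shape `λ/μ`. -/
def skewCells (lam mu : YoungDiagram) : Finset (ℕ × ℕ) :=
  lam.cells \ mu.cells

/-- `|λ/μ|`, the number of boxes. -/
def skewSize (lam mu : YoungDiagram) : ℕ :=
  (skewCells lam mu).card

/-- `c(λ/μ)`, the number of columns of `λ/μ` (those containing a box). -/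
def numColumns (lam mu : YoungDiagram) : ℕ :=
  ((skewCells lam mu).image Prod.snd).card

/-- `λ/μ` is a vertical strip: it has at most one box in each row. -/
def IsVerticalStrip (lam mu : YoungDiagram) : Prop :=
  ∀ c ∈ skewCells lam mu, ∀ d ∈ skewCells lam mu, c.1 = d.1 → c = d

instance (lam mu : YoungDiagram) : Decidable (IsVerticalStrip lam mu) := by
  unfold IsVerticalStrip
  infer_instance

/-- A reverse plane partition of shape `λ/μ`: a filling of the boxes that is weakly increasing in
every row and column. As the variables are `x 0, x 1, …`, the fillings are by natural numbers.
For extensionality the entries outside `λ/μ` are required to be `0`. -/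
structure ReversePlanePartition (lam mu : YoungDiagram) where
  entry : ℕ → ℕ → ℕ
  row_weak : ∀ {i j₁ j₂ : ℕ}, j₁ < j₂ → (i, j₁) ∈ skewCells lam mu →
    (i, j₂) ∈ skewCells lam mu → entry i j₁ ≤ entry i j₂
  col_weak : ∀ {i₁ i₂ j : ℕ}, i₁ < i₂ → (i₁, j) ∈ skewCells lam mu →
    (i₂, j) ∈ skewCells lam mu → entry i₁ j ≤ entry i₂ j
  zeros : ∀ {i j : ℕ}, (i, j) ∉ skewCells lam mu → entry i j = 0

/-- The exponent vector of `x^T`: the exponent of `x i` is the number of columns of `T` that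
contain `i`. -/
def ReversePlanePartition.weight {lam mu : YoungDiagram} (T : ReversePlanePartition lam mu) :
    ℕ →₀ ℕ :=
  ∑ p ∈ (skewCells lam mu).image (fun c => (T.entry c.1 c.2, c.2)), Finsupp.single p.1 1

/-- The dual stable Grothendieck polynomial `g_{λ/μ} = ∑_T x^T`, summed over the reverse plane
partitions `T` of shape `λ/μ`. -/
def dualG (K : Type*) [CommRing K] (lam mu : YoungDiagram) : MvPowerSeries ℕ K :=
  fun α => (Nat.card {T : ReversePlanePartition lam mu // T.weight = α} : K)

/-- The one-column shape `(1^k)`. -/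
def column (k : ℕ) : YoungDiagram where
  cells := Finset.range k ×ˢ {0}
  isLowerSet := by
    rintro ⟨a, b⟩ ⟨c, d⟩ ⟨h₁, h₂⟩ h
    simp only [Finset.coe_product, Finset.coe_range, Finset.coe_singleton, Set.mem_prod,
      Set.mem_Iio, Set.mem_singleton_iff] at h ⊢
    simp only at h₁ h₂
    omega

theorem finite_Icc_youngDiagram (mu lam : YoungDiagram) : (Set.Icc mu lam).Finite := by
  refine Set.Finite.of_finite_image (f := YoungDiagram.cells) ?_
    (fun a _ b _ h => YoungDiagram.ext h)
  refine (Finset.finite_toSet lam.cells.powerset).subset ?_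
  rintro _ ⟨nu, hnu, rfl⟩
  simpa using YoungDiagram.cells_subset_iff.2 hnu.2

/-- `Finset.Icc μ λ` is the set of all `ν` with `μ ⊂ ν ⊂ λ`. -/
instance : LocallyFiniteOrder YoungDiagram :=
  LocallyFiniteOrder.ofFiniteIcc finite_Icc_youngDiagram

/-- `t^{c(λ/ν)} (t+1)^{|λ/ν| - c(λ/ν)}`; note that `c(λ/ν) ≤ |λ/ν|`. -/
def stripCoeff (t : K) (lam nu : YoungDiagram) : K :=
  t ^ numColumns lam nu * (t + 1) ^ (skewSize lam nu - numColumns lam nu)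

end

end DualGrothendieck

/-!
Work in the incidence algebra of Young's lattice. The coefficient of `x^α` in `g_{λ/μ}` is the
`(μ, λ)` entry of a product of operators `D_b` (the indicators of skew shapes with `b` nonempty
columns), one for each part of `α`. Put `U(y) = ∑_b y^b D_b`, whose entries are `y^{c(λ/μ)}`, and
let `V(t)` have the entries `t^{c(λ/μ)} (t+1)^{|λ/μ| - c(λ/μ)}` on vertical strips. Summing column
by column gives `U(y) V(t) = V(t) U(y)` and `V(t) U(-t) = 1`. Hence `U(-t)` and `U(y)` commute for
all `t` and `y`, so the `D_b` commute with one another and `g_{λ/μ}` is symmetric.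

The map `f ↦ f(-t, x₁, x₂, …)` is an algebra endomorphism of `Λ` which acts on the `g_{λ/μ}` by
multiplication with `U(-t)`. It is inverse to `E(t)^⊥`, as one checks on Schur functions. Hence
`E(t)^⊥` is an automorphism that acts on the `g_{λ/μ}` as `V(t)`, and multiplying by `V(t)` on the
left or on the right is the same, since `V(t)` commutes with the `D_b`.
-/

namespace DualGrothendieck

noncomputable section

/-! ### Young diagrams in column coordinates -/

theorem le_iff_colLen_le {mu lam : YoungDiagram} :
    mu ≤ lam ↔ ∀ j, mu.colLen j ≤ lam.colLen j := by
  constructor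
  · intro h j
    refine le_of_forall_lt fun i hi => ?_
    exact YoungDiagram.mem_iff_lt_colLen.1 (h (YoungDiagram.mem_iff_lt_colLen.2 hi))
  · rintro h ⟨i, j⟩ hc
    exact YoungDiagram.mem_iff_lt_colLen.2 ((YoungDiagram.mem_iff_lt_colLen.1 hc).trans_le (h j))

theorem eq_of_colLen_eq {mu lam : YoungDiagram} (h : ∀ j, mu.colLen j = lam.colLen j) :
    mu = lam :=
  le_antisymm (le_iff_colLen_le.2 fun j => (h j).le) (le_iff_colLen_le.2 fun j => (h j).ge)

theorem mem_skewCells {lam mu : YoungDiagram} {i j : ℕ} :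
    (i, j) ∈ skewCells lam mu ↔ mu.colLen j ≤ i ∧ i < lam.colLen j := by
  simp only [skewCells, Finset.mem_sdiff, YoungDiagram.mem_cells, YoungDiagram.mem_iff_lt_colLen,
    not_lt, and_comm]

theorem colLen_eq_zero_of_le {lam : YoungDiagram} {n j : ℕ} (hn : lam.colLen n = 0)
    (h : n ≤ j) : lam.colLen j = 0 :=
  Nat.eq_zero_of_le_zero (hn ▸ lam.colLen_anti n j h)

theorem colLen_rowLen_zero (lam : YoungDiagram) : lam.colLen (lam.rowLen 0) = 0 := by
  by_contra hne
  have : (0, lam.rowLen 0) ∈ lam := YoungDiagram.mem_iff_lt_colLen.2 (Nat.pos_of_ne_zero hne)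
  exact lt_irrefl _ (YoungDiagram.mem_iff_lt_rowLen.1 this)

theorem lt_of_mem_skewCells {lam mu : YoungDiagram} {n i j : ℕ} (hn : lam.colLen n = 0)
    (h : (i, j) ∈ skewCells lam mu) : j < n := by
  by_contra hj
  have := (mem_skewCells.1 h).2
  rw [colLen_eq_zero_of_le hn (not_lt.1 hj)] at this
  exact Nat.not_lt_zero _ this

theorem numColumns_eq_card {lam : YoungDiagram} (mu : YoungDiagram) {n : ℕ}
    (hn : lam.colLen n = 0) :
    numColumns lam mu = ((Finset.range n).filter fun j => mu.colLen j < lam.colLen j).card := by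
  unfold numColumns
  congr 1
  ext j
  simp only [Finset.mem_image, Prod.exists, exists_eq_right, Finset.mem_filter, Finset.mem_range]
  constructor
  · rintro ⟨i, h⟩
    exact ⟨lt_of_mem_skewCells hn h, (mem_skewCells.1 h).1.trans_lt (mem_skewCells.1 h).2⟩
  · rintro ⟨-, h⟩
    exact ⟨_, mem_skewCells.2 ⟨le_rfl, h⟩⟩

theorem skewSize_eq_sum {lam : YoungDiagram} (mu : YoungDiagram) {n : ℕ}
    (hn : lam.colLen n = 0) :
    skewSize lam mu = ∑ j ∈ Finset.range n, (lam.colLen j - mu.colLen j) := by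
  have hmaps : ∀ c ∈ skewCells lam mu, c.2 ∈ Finset.range n := fun c hc =>
    Finset.mem_range.2 (lt_of_mem_skewCells hn hc)
  rw [skewSize, Finset.card_eq_sum_card_fiberwise hmaps]
  refine Finset.sum_congr rfl fun j _ => ?_
  have hcol : (skewCells lam mu).filter (fun c => c.2 = j) =
      Finset.Ico (mu.colLen j) (lam.colLen j) ×ˢ {j} := by
    ext ⟨i, k⟩
    simp only [Finset.mem_filter, mem_skewCells, Finset.mem_product, Finset.mem_Ico,
      Finset.mem_singleton]
    exact and_congr_left fun h => by rw [h]
  rw [hcol, Finset.card_product, Nat.card_Ico, Finset.card_singleton, mul_one]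

theorem isVerticalStrip_iff {lam mu : YoungDiagram} :
    IsVerticalStrip lam mu ↔ ∀ j, lam.colLen (j + 1) ≤ mu.colLen j := by
  constructor
  · intro h j
    by_contra! hlt
    have hleft : (mu.colLen j, j) ∈ skewCells lam mu :=
      mem_skewCells.2 ⟨le_rfl, hlt.trans_le (lam.colLen_anti j (j + 1) j.le_succ)⟩
    have hright : (mu.colLen j, j + 1) ∈ skewCells lam mu :=
      mem_skewCells.2 ⟨mu.colLen_anti j (j + 1) j.le_succ, hlt⟩
    simpa using h _ hleft _ hright rfl
  · intro h
    have not_lt_column : ∀ {i j k : ℕ}, (i, j) ∈ skewCells lam mu → (i, k) ∈ skewCells lam mu →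
        ¬ j < k := by
      intro i j k hj hk hjk
      have := (mem_skewCells.1 hk).2.trans_le ((lam.colLen_anti (j + 1) k hjk).trans (h j))
      exact this.not_ge (mem_skewCells.1 hj).1
    rintro ⟨i, j⟩ hc ⟨_, k⟩ hd rfl
    rw [le_antisymm (not_lt.1 (not_lt_column hd hc)) (not_lt.1 (not_lt_column hc hd))]

theorem exists_youngDiagram_colLen_eq {f : ℕ → ℕ} (hf : Antitone f) {n : ℕ} (hn : f n = 0) :
    ∃ nu : YoungDiagram, ∀ j, nu.colLen j = f j := by
  refine ⟨⟨(Finset.range (f 0) ×ˢ Finset.range n).filter fun c => c.1 < f c.2, ?_⟩, fun j => ?_⟩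
  · rintro ⟨a, b⟩ ⟨c, d⟩ ⟨hrow : c ≤ a, hcol : d ≤ b⟩ h
    simp only [Finset.coe_filter, Finset.mem_product, Finset.mem_range, Set.mem_ofPred_eq] at h ⊢
    have := hf hcol
    omega
  · refine eq_of_forall_lt_iff fun i => ?_
    rw [← YoungDiagram.mem_iff_lt_colLen, ← YoungDiagram.mem_cells]
    simp only [Finset.mem_filter, Finset.mem_product, Finset.mem_range, and_iff_right_iff_imp]
    refine fun h => ⟨h.trans_le (hf (Nat.zero_le j)), ?_⟩
    by_contra hj
    have := hf (not_lt.1 hj)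
    omega

/-- As `hi (j + 1) ≤ lo j`, the columns may be chosen independently: every choice within the
bounds is antitone. -/
theorem sum_prod_colLen {R : Type*} [CommSemiring R] {lo hi : ℕ → ℕ} {n : ℕ}
    (hsep : ∀ j, hi (j + 1) ≤ lo j) (hle : ∀ j, lo j ≤ hi j) (hn : ∀ j, n ≤ j → hi j = 0)
    {S : Finset YoungDiagram}
    (hS : ∀ nu, nu ∈ S ↔ ∀ j, lo j ≤ nu.colLen j ∧ nu.colLen j ≤ hi j) (F : ℕ → ℕ → R) :
    ∑ nu ∈ S, ∏ j ∈ Finset.range n, F j (nu.colLen j) =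
      ∏ j ∈ Finset.range n, ∑ m ∈ Finset.Icc (lo j) (hi j), F j m := by
  rw [Finset.prod_range, Finset.prod_univ_sum]
  refine Finset.sum_bij (fun nu _ j => nu.colLen j) ?_ ?_ ?_ fun _ _ => Finset.prod_range _
  · intro nu hnu
    simpa only [Fintype.mem_piFinset, Finset.mem_Icc] using fun j : Fin n => (hS nu).1 hnu j
  · intro nu hnu nu' hnu' h
    refine eq_of_colLen_eq fun j => ?_
    rcases lt_or_ge j n with hj | hj
    · exact congrFun h ⟨j, hj⟩
    · have := ((hS nu).1 hnu j).2
      have := ((hS nu').1 hnu' j).2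
      have := hn j hj
      omega
  · intro p hp
    simp only [Fintype.mem_piFinset, Finset.mem_Icc] at hp
    let f : ℕ → ℕ := fun j => if h : j < n then p ⟨j, h⟩ else 0
    have hbounds : ∀ j, lo j ≤ f j ∧ f j ≤ hi j := by
      intro j
      rcases lt_or_ge j n with hj | hj
      · simpa [f, hj] using hp ⟨j, hj⟩
      · simpa [f, hj.not_gt, hn j hj] using hle j
    have hanti : Antitone f := antitone_nat_of_succ_le fun j =>
      ((hbounds (j + 1)).2.trans (hsep j)).trans (hbounds j).1
    obtain ⟨nu, hnu⟩ := exists_youngDiagram_colLen_eq hanti (n := n) (by simp [f])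
    refine ⟨nu, (hS nu).2 fun j => hnu j ▸ hbounds j, ?_⟩
    funext j
    simp [hnu, f]

/-! ### Weights of a single column -/

section ColumnWeights

variable {R : Type*} [CommRing R] (t y : R)

/-- The contribution `t (t + 1)^(r - 1)` of a column with `r > 0` boxes to `stripCoeff`. -/
def stripFactor (r : ℕ) : R := if r = 0 then 1 else t * (t + 1) ^ (r - 1)

/-- The contribution of a column with `r` boxes to `y^{c(λ/μ)}`. -/
def columnFactor (r : ℕ) : R := if r = 0 then 1 else y

theorem stripCoeff_eq_prod {lam : YoungDiagram} (mu : YoungDiagram) {n : ℕ}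
    (hn : lam.colLen n = 0) :
    stripCoeff t lam mu =
      ∏ j ∈ Finset.range n, stripFactor t (lam.colLen j - mu.colLen j) := by
  have hfactor : ∀ r, stripFactor t r = t ^ (if 0 < r then 1 else 0) * (t + 1) ^ (r - 1) := by
    rintro (_ | r) <;> simp [stripFactor]
  have hcolumns : numColumns lam mu =
      ∑ j ∈ Finset.range n, if 0 < lam.colLen j - mu.colLen j then 1 else 0 := by
    simp only [numColumns_eq_card mu hn, Finset.card_filter, tsub_pos_iff_lt]
  have hrest : skewSize lam mu - numColumns lam mu =
      ∑ j ∈ Finset.range n, (lam.colLen j - mu.colLen j - 1) := by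
    rw [hcolumns, skewSize_eq_sum mu hn, ← Finset.sum_tsub_distrib _ fun j _ => by
      split_ifs <;> omega]
    exact Finset.sum_congr rfl fun j _ => by split_ifs <;> omega
  simp only [hfactor]
  rw [stripCoeff, hrest, hcolumns, Finset.prod_mul_distrib, Finset.prod_pow_eq_pow_sum,
    Finset.prod_pow_eq_pow_sum]

theorem pow_numColumns_eq_prod {lam : YoungDiagram} (mu : YoungDiagram) {n : ℕ}
    (hn : lam.colLen n = 0) :
    y ^ numColumns lam mu =
      ∏ j ∈ Finset.range n, columnFactor y (lam.colLen j - mu.colLen j) := by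
  simp only [numColumns_eq_card mu hn, columnFactor, tsub_eq_zero_iff_le, ← not_lt, ite_not,
    Finset.prod_ite, Finset.prod_const, one_pow, mul_one]

theorem sum_stripFactor (k : ℕ) :
    ∑ r ∈ Finset.range (k + 1), stripFactor t r = (t + 1) ^ k := by
  induction k with
  | zero => simp [stripFactor]
  | succ k ih =>
    rw [Finset.sum_range_succ, ih, stripFactor, if_neg k.succ_ne_zero, Nat.add_sub_cancel]
    ring

/-- The total weight of the ways to split a column of `d` boxes into `i ≤ a` boxes weighted by
`stripFactor t` and `d - i` boxes weighted by `columnFactor y`. -/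
def columnSum (d a : ℕ) : R :=
  ∑ i ∈ Finset.range (min d a + 1), stripFactor t i * columnFactor y (d - i)

theorem columnSum_of_le {d a : ℕ} (h : d ≤ a) : columnSum t y d a = columnSum t y d d := by
  rw [columnSum, columnSum, min_eq_left h, min_self]

theorem columnSum_of_lt {d a : ℕ} (h : a < d) : columnSum t y d a = (t + 1) ^ a * y := by
  rw [columnSum, min_eq_right h.le, ← sum_stripFactor, Finset.sum_mul]
  refine Finset.sum_congr rfl fun i hi => ?_
  have := Finset.mem_range.1 hi
  rw [columnFactor, if_neg (by omega)]

theorem columnSum_zero : columnSum t y 0 0 = 1 := by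
  simp [columnSum, stripFactor, columnFactor]

theorem columnSum_self_succ (d : ℕ) :
    columnSum t y (d + 1) (d + 1) = (t + 1) ^ d * (t + y) := by
  have hlt := columnSum_of_lt t y d.lt_succ_self
  rw [columnSum, min_eq_right d.le_succ] at hlt
  rw [columnSum, min_self, Finset.sum_range_succ, hlt]
  simp only [stripFactor, columnFactor, Nat.succ_ne_zero, if_false, Nat.add_sub_cancel,
    Nat.sub_self, if_true]
  ring

theorem columnSum_neg_self {d : ℕ} (hd : d ≠ 0) : columnSum t (-t) d d = 0 := by
  obtain ⟨d, rfl⟩ := Nat.exists_eq_succ_of_ne_zero hd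
  rw [columnSum_self_succ, add_neg_cancel, mul_zero]

theorem exists_columnSum_eq_mul (d a : ℕ) :
    ∃ T : R, columnSum t y d a = T * columnFactor y (d - a) ∧
      columnSum t y d d = T * columnSum t y (d - a) (d - a) := by
  rcases le_or_gt d a with h | h
  · refine ⟨columnSum t y d d, ?_, ?_⟩
    · rw [columnSum_of_le t y h, Nat.sub_eq_zero_of_le h, columnFactor, if_pos rfl, mul_one]
    · rw [Nat.sub_eq_zero_of_le h, columnSum_zero, mul_one]
  · obtain ⟨k, rfl⟩ := Nat.exists_eq_add_of_lt h
    refine ⟨(t + 1) ^ a, ?_, ?_⟩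
    · rw [columnSum_of_lt t y h, columnFactor, if_neg (by omega)]
    · rw [show a + k + 1 - a = k + 1 by omega, columnSum_self_succ, columnSum_self_succ]
      ring

theorem columnSum_mul_self (d a : ℕ) :
    columnSum t y d a * columnSum t y (d - a) (d - a) =
      columnFactor y (d - a) * columnSum t y d d := by
  obtain ⟨T, hsum, hself⟩ := exists_columnSum_eq_mul t y d a
  rw [hsum, hself]
  ring

/-- Here `a` and `b` bound the boxes that the neighbouring columns on the right and on the left
allow; by `hstep` the excess `d j - a j` over the first bound is passed on to the next column. -/
theorem prod_columnSum_eq {d a b : ℕ → ℕ} (hzero : d 0 - b 0 = 0)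
    (hstep : ∀ j, d (j + 1) - b (j + 1) = d j - a j) {n : ℕ} (hn : d n - b n = 0) :
    ∏ j ∈ Finset.range n, columnSum t y (d j) (a j) =
      ∏ j ∈ Finset.range n, columnSum t y (d j) (b j) := by
  suffices ∀ n, ∃ Z : R,
      ∏ j ∈ Finset.range n, columnSum t y (d j) (a j) = Z * columnFactor y (d n - b n) ∧
      ∏ j ∈ Finset.range n, columnSum t y (d j) (b j) =
        Z * columnSum t y (d n - b n) (d n - b n) by
    obtain ⟨Z, ha, hb⟩ := this n
    rw [ha, hb, hn, columnSum_zero, columnFactor, if_pos rfl]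
  intro n
  induction n with
  | zero => exact ⟨1, by simp [hzero, columnSum_zero, columnFactor]⟩
  | succ n ih =>
    obtain ⟨Z, ha, hb⟩ := ih
    obtain ⟨T, hsum, hself⟩ := exists_columnSum_eq_mul t y (d n) (a n)
    refine ⟨Z * columnFactor y (d n - b n) * T, ?_, ?_⟩
    · rw [Finset.prod_range_succ, ha, hsum, hstep, mul_assoc _ T]
    · rw [Finset.prod_range_succ, hb, hstep, mul_assoc _ T, ← hself, mul_assoc, mul_assoc,
        mul_comm (columnSum t y (d n - b n) _), columnSum_mul_self]

theorem sum_Icc_max_eq_columnSum {L L' M : ℕ} (hL : L' ≤ L) (hM : M ≤ L) :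
    ∑ m ∈ Finset.Icc (max L' M) L, columnFactor y (m - M) * stripFactor t (L - m) =
      columnSum t y (L - M) (L - L') := by
  refine Finset.sum_nbij' (fun m => L - m) (fun i => L - i) ?_ ?_ ?_ ?_ fun m hm => ?_
  all_goals simp only [Finset.mem_Icc, Finset.mem_range] at *
  any_goals omega
  rw [mul_comm, show L - M - (L - m) = m - M by omega]

theorem sum_Icc_min_eq_columnSum {L M P : ℕ} (hP : M ≤ P) (hM : M ≤ L) :
    ∑ m ∈ Finset.Icc M (min P L), stripFactor t (m - M) * columnFactor y (L - m) =
      columnSum t y (L - M) (P - M) := by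
  refine Finset.sum_nbij' (fun m => m - M) (fun i => M + i) ?_ ?_ ?_ ?_ fun m hm => ?_
  all_goals simp only [Finset.mem_Icc, Finset.mem_range] at *
  any_goals omega
  rw [show L - M - (m - M) = L - m by omega]

end ColumnWeights

/-! ### The incidence algebra of Young's lattice -/

instance : DecidableEq YoungDiagram := fun a b =>
  decidable_of_iff (a.cells = b.cells) YoungDiagram.ext_iff.symm

instance : DecidableLE YoungDiagram := fun a b =>
  decidable_of_iff (a.cells ⊆ b.cells) YoungDiagram.cells_subset_iff

section IncidenceElement

variable {R α : Type*} [Preorder α] [DecidableLE α]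

/-- The element of the incidence algebra with the values `f a b` for `a ≤ b`; the other values of
`f` are ignored. -/
def incidenceElement [Zero R] (f : α → α → R) : IncidenceAlgebra R α where
  toFun a b := if a ≤ b then f a b else 0
  eq_zero_of_not_le' _ _ h := if_neg h

theorem incidenceElement_apply [Zero R] (f : α → α → R) {a b : α} (h : a ≤ b) :
    incidenceElement f a b = f a b := if_pos h

theorem incidenceElement_mul_apply [LocallyFiniteOrder α] [NonUnitalNonAssocSemiring R]
    (f g : α → α → R) (a b : α) :
    (incidenceElement f * incidenceElement g) a b = ∑ x ∈ Finset.Icc a b, f a x * g x b := by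
  rw [IncidenceAlgebra.mul_apply]
  refine Finset.sum_congr rfl fun x hx => ?_
  rw [Finset.mem_Icc] at hx
  rw [incidenceElement_apply f hx.1, incidenceElement_apply g hx.2]

end IncidenceElement

section YoungLattice

variable {R : Type*} [CommRing R]

/-- The element `y^{c(λ/μ)}` of the incidence algebra of Young's lattice. -/
def columnWeight (y : R) : IncidenceAlgebra R YoungDiagram :=
  incidenceElement fun mu lam => y ^ numColumns lam mu

/-- The element of the incidence algebra of Young's lattice through which `E(t)^⊥` acts on the
`g_{λ/μ}`: `stripCoeff t λ μ` on vertical strips `λ/μ`, and `0` elsewhere. -/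
def stripWeight (t : R) : IncidenceAlgebra R YoungDiagram :=
  incidenceElement fun mu lam => if IsVerticalStrip lam mu then stripCoeff t lam mu else 0

/-- The length of column `j - 1` of `μ`, which bounds column `j` of `λ` when `λ/μ` is a vertical
strip. Column `0` has no left neighbour; there `colLen 0` of an ambient shape `λ` is used. -/
def prevColLen (lam mu : YoungDiagram) : ℕ → ℕ
  | 0 => lam.colLen 0
  | j + 1 => mu.colLen j

theorem colLen_le_prevColLen {lam mu : YoungDiagram} (h : mu ≤ lam) :
    ∀ j, mu.colLen j ≤ prevColLen lam mu j
  | 0 => le_iff_colLen_le.1 h 0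
  | j + 1 => mu.colLen_anti j (j + 1) j.le_succ

theorem columnWeight_mul_stripWeight_apply (t y : R) {mu lam : YoungDiagram} (h : mu ≤ lam)
    {n : ℕ} (hn : lam.colLen n = 0) :
    (columnWeight y * stripWeight t) mu lam = ∏ j ∈ Finset.range n,
      columnSum t y (lam.colLen j - mu.colLen j) (lam.colLen j - lam.colLen (j + 1)) := by
  have hcol := le_iff_colLen_le.1 h
  have hanti : ∀ j, lam.colLen (j + 1) ≤ lam.colLen j := fun j =>
    lam.colLen_anti j (j + 1) j.le_succ
  have hbounds : ∀ nu, nu ∈ (Finset.Icc mu lam).filter (IsVerticalStrip lam) ↔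
      ∀ j, max (lam.colLen (j + 1)) (mu.colLen j) ≤ nu.colLen j ∧
        nu.colLen j ≤ lam.colLen j := by
    intro nu
    simp only [Finset.mem_filter, Finset.mem_Icc, isVerticalStrip_iff, le_iff_colLen_le,
      max_le_iff, forall_and]
    tauto
  have hcell : ∀ nu ∈ (Finset.Icc mu lam).filter (IsVerticalStrip lam),
      y ^ numColumns nu mu * stripCoeff t lam nu = ∏ j ∈ Finset.range n,
        columnFactor y (nu.colLen j - mu.colLen j) *
          stripFactor t (lam.colLen j - nu.colLen j) := by
    intro nu hnu
    have hnu0 : nu.colLen n = 0 := Nat.eq_zero_of_le_zero (hn ▸ ((hbounds nu).1 hnu n).2)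
    rw [Finset.prod_mul_distrib, stripCoeff_eq_prod t nu hn, pow_numColumns_eq_prod y mu hnu0]
  simp only [columnWeight, stripWeight, incidenceElement_mul_apply, mul_ite, mul_zero]
  rw [← Finset.sum_filter, Finset.sum_congr rfl hcell,
    sum_prod_colLen (fun j => le_max_left _ _) (fun j => max_le (hanti j) (hcol j))
      (fun j => colLen_eq_zero_of_le hn) hbounds
      fun j m => columnFactor y (m - mu.colLen j) * stripFactor t (lam.colLen j - m)]
  exact Finset.prod_congr rfl fun j _ => sum_Icc_max_eq_columnSum t y (hanti j) (hcol j)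

theorem stripWeight_mul_columnWeight_apply (t y : R) {mu lam : YoungDiagram} (h : mu ≤ lam)
    {n : ℕ} (hn : lam.colLen n = 0) :
    (stripWeight t * columnWeight y) mu lam = ∏ j ∈ Finset.range n,
      columnSum t y (lam.colLen j - mu.colLen j) (prevColLen lam mu j - mu.colLen j) := by
  have hcol := le_iff_colLen_le.1 h
  have hprev := colLen_le_prevColLen h
  have hbounds : ∀ nu, nu ∈ (Finset.Icc mu lam).filter (IsVerticalStrip · mu) ↔
      ∀ j, mu.colLen j ≤ nu.colLen j ∧
        nu.colLen j ≤ min (prevColLen lam mu j) (lam.colLen j) := by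
    intro nu
    simp only [Finset.mem_filter, Finset.mem_Icc, isVerticalStrip_iff, le_iff_colLen_le,
      le_min_iff, forall_and]
    refine ⟨fun hnu => ⟨hnu.1.1, fun j => ?_, hnu.1.2⟩,
      fun hnu => ⟨⟨hnu.1, hnu.2.2⟩, fun j => hnu.2.1 (j + 1)⟩⟩
    cases j with
    | zero => exact hnu.1.2 0
    | succ j => exact hnu.2 j
  have hcell : ∀ nu ∈ (Finset.Icc mu lam).filter (IsVerticalStrip · mu),
      stripCoeff t nu mu * y ^ numColumns lam nu = ∏ j ∈ Finset.range n,
        stripFactor t (nu.colLen j - mu.colLen j) *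
          columnFactor y (lam.colLen j - nu.colLen j) := by
    intro nu hnu
    have hnu0 : nu.colLen n = 0 :=
      Nat.eq_zero_of_le_zero (hn ▸ (le_min_iff.1 ((hbounds nu).1 hnu n).2).2)
    rw [Finset.prod_mul_distrib, stripCoeff_eq_prod t mu hnu0, pow_numColumns_eq_prod y nu hn]
  simp only [columnWeight, stripWeight, incidenceElement_mul_apply, ite_mul, zero_mul]
  rw [← Finset.sum_filter, Finset.sum_congr rfl hcell,
    sum_prod_colLen (hi := fun j => min (prevColLen lam mu j) (lam.colLen j))
      (fun j => min_le_left _ _) (fun j => le_min (hprev j) (hcol j))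
      (fun j hj => by simp only [colLen_eq_zero_of_le hn hj, Nat.min_zero]) hbounds
      fun j m => stripFactor t (m - mu.colLen j) * columnFactor y (lam.colLen j - m)]
  exact Finset.prod_congr rfl fun j _ => sum_Icc_min_eq_columnSum t y (hprev j) (hcol j)

theorem columnWeight_mul_stripWeight_comm (t y : R) :
    columnWeight y * stripWeight t = stripWeight t * columnWeight y := by
  ext mu lam h
  have hn := colLen_rowLen_zero lam
  have hcol := le_iff_colLen_le.1 h
  rw [columnWeight_mul_stripWeight_apply t y h hn, stripWeight_mul_columnWeight_apply t y h hn]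
  refine prod_columnSum_eq t y ?_ (fun j => ?_) ?_
  · simp only [prevColLen, Nat.sub_self]
  · have := hcol j
    have := hcol (j + 1)
    have := lam.colLen_anti j (j + 1) j.le_succ
    have := mu.colLen_anti j (j + 1) j.le_succ
    simp only [prevColLen]
    omega
  · rw [hn, Nat.zero_sub, Nat.zero_sub]

theorem stripWeight_mul_columnWeight_neg (t : R) : stripWeight t * columnWeight (-t) = 1 := by
  ext mu lam h
  rw [stripWeight_mul_columnWeight_apply t (-t) h (colLen_rowLen_zero lam),
    IncidenceAlgebra.one_apply]
  have hcol := le_iff_colLen_le.1 h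
  split_ifs with heq
  · subst heq
    exact Finset.prod_eq_one fun j _ => by
      rw [Nat.sub_self, columnSum_of_le t (-t) (Nat.zero_le _), columnSum_zero]
  · have hex : ∃ j, mu.colLen j ≠ lam.colLen j := by
      by_contra! hall
      exact heq (eq_of_colLen_eq hall)
    -- In the first column that is not empty, the left neighbour imposes no bound.
    let j := Nat.find hex
    have hj : mu.colLen j ≠ lam.colLen j := Nat.find_spec hex
    have hprev : lam.colLen j ≤ prevColLen lam mu j := by
      rcases hk : j with _ | k
      · exact le_rfl
      · have hlast : mu.colLen k = lam.colLen k := not_not.1 (Nat.find_min hex (by omega))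
        exact (lam.colLen_anti k (k + 1) k.le_succ).trans hlast.ge
    have hmem : j < lam.rowLen 0 := by
      by_contra! hle
      have := colLen_eq_zero_of_le (colLen_rowLen_zero lam) hle
      have := hcol j
      omega
    refine Finset.prod_eq_zero (Finset.mem_range.2 hmem) ?_
    rw [columnSum_of_le t (-t) (Nat.sub_le_sub_right hprev _), columnSum_neg_self]
    have := hcol j
    omega

theorem columnWeight_neg_mul_stripWeight (t : R) : columnWeight (-t) * stripWeight t = 1 := by
  rw [columnWeight_mul_stripWeight_comm, stripWeight_mul_columnWeight_neg]

theorem columnWeight_comm (x y : R) :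
    columnWeight x * columnWeight y = columnWeight y * columnWeight x := by
  have hleft : stripWeight (-x) * columnWeight x = 1 := by
    simpa using stripWeight_mul_columnWeight_neg (-x)
  have hright : columnWeight x * stripWeight (-x) = 1 := by
    simpa using columnWeight_neg_mul_stripWeight (-x)
  calc columnWeight x * columnWeight y
      = columnWeight x * (columnWeight y * stripWeight (-x)) * columnWeight x := by
        rw [mul_assoc, mul_assoc, hleft, mul_one]
    _ = columnWeight y * columnWeight x := by
        rw [columnWeight_mul_stripWeight_comm, ← mul_assoc, hright, one_mul]

/-- The element of the incidence algebra of Young's lattice that indicates `c(λ/μ) = b`: the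
coefficient of `y^b` in `columnWeight y`. -/
def columnIndicator (R : Type*) [CommRing R] (b : ℕ) : IncidenceAlgebra R YoungDiagram :=
  incidenceElement fun mu lam => if numColumns lam mu = b then 1 else 0

theorem columnIndicator_apply (b : ℕ) {mu lam : YoungDiagram} (h : mu ≤ lam) :
    columnIndicator R b mu lam = if numColumns lam mu = b then 1 else 0 :=
  incidenceElement_apply _ h

open Polynomial in
theorem card_filter_numColumns (mu lam : YoungDiagram) (a b : ℕ) :
    ((Finset.Icc mu lam).filter fun nu => numColumns nu mu = a ∧ numColumns lam nu = b).card =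
      ((Finset.Icc mu lam).filter fun nu => numColumns nu mu = b ∧ numColumns lam nu = a).card := by
  have hcoeff : ∀ c d : ℕ, (((C X : ℤ[X][X]) ^ c * X ^ d).coeff b).coeff a =
      if c = a ∧ d = b then 1 else 0 := by
    intro c d
    rw [← C_pow, coeff_C_mul, coeff_X_pow, mul_ite, mul_one, mul_zero, apply_ite (coeff · a),
      coeff_X_pow, coeff_zero, ite_and]
    simp only [eq_comm]
    split_ifs <;> rfl
  have hswap : ∀ c d : ℕ, (((X : ℤ[X][X]) ^ c * (C X) ^ d).coeff b).coeff a =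
      if c = b ∧ d = a then 1 else 0 := by
    intro c d
    rw [mul_comm, hcoeff]
    simp only [and_comm]
  simpa only [columnWeight, incidenceElement_mul_apply, finsetSum_coeff, hcoeff, hswap,
    Finset.sum_boole, Nat.cast_inj] using congrArg
      (fun f : IncidenceAlgebra ℤ[X][X] YoungDiagram => ((f mu lam).coeff b).coeff a)
      (columnWeight_comm (C X) X)

theorem columnIndicator_comm (a b : ℕ) :
    Commute (columnIndicator R a) (columnIndicator R b) := by
  have hcard : ∀ (a b : ℕ) (mu lam : YoungDiagram),
      (columnIndicator R a * columnIndicator R b) mu lam = (((Finset.Icc mu lam).filter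
        fun nu => numColumns nu mu = a ∧ numColumns lam nu = b).card : R) := by
    intro a b mu lam
    simp only [columnIndicator, incidenceElement_mul_apply, ← Finset.sum_boole, ite_and,
      ite_mul, one_mul, zero_mul]
  ext mu lam _
  rw [hcard, hcard, card_filter_numColumns]

theorem numColumns_eq_zero_iff {mu lam : YoungDiagram} (h : mu ≤ lam) :
    numColumns lam mu = 0 ↔ mu = lam := by
  rw [numColumns, Finset.card_eq_zero, Finset.image_eq_empty, skewCells,
    Finset.sdiff_eq_empty_iff_subset, YoungDiagram.cells_subset_iff]
  exact ⟨h.antisymm, fun heq => heq.ge⟩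

theorem columnIndicator_zero : columnIndicator R 0 = 1 := by
  ext mu lam h
  rw [columnIndicator_apply 0 h, IncidenceAlgebra.one_apply]
  simp only [numColumns_eq_zero_iff h]

end YoungLattice

/-! ### Prepending an exponent -/

/-- The exponent vector `(b, β 0, β 1, …)`; recursion over it replaces recursion over the
variables. -/
def consExp (b : ℕ) (β : ℕ →₀ ℕ) : ℕ →₀ ℕ :=
  Finsupp.single 0 b + β.mapDomain Nat.succ

@[simp]
theorem consExp_apply_zero (b : ℕ) (β : ℕ →₀ ℕ) : consExp b β 0 = b := by
  rw [consExp, Finsupp.add_apply, Finsupp.single_eq_same,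
    Finsupp.mapDomain_of_notMem_range _ _ (by simp), add_zero]

@[simp]
theorem consExp_apply_succ (b : ℕ) (β : ℕ →₀ ℕ) (i : ℕ) : consExp b β (i + 1) = β i := by
  rw [consExp, Finsupp.add_apply, Finsupp.single_eq_of_ne i.succ_ne_zero, zero_add]
  exact Finsupp.mapDomain_apply Nat.succ_injective β i

theorem eq_consExp_iff {α β : ℕ →₀ ℕ} {b : ℕ} :
    α = consExp b β ↔ α 0 = b ∧ ∀ i, α (i + 1) = β i := by
  refine ⟨fun h => by simp [h], fun h => ?_⟩
  ext i
  cases i with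
  | zero => simpa using h.1
  | succ i => simpa using h.2 i

theorem consExp_inj {b b' : ℕ} {β β' : ℕ →₀ ℕ} :
    consExp b β = consExp b' β' ↔ b = b' ∧ β = β' := by
  rw [eq_consExp_iff, Finsupp.ext_iff]
  simp only [consExp_apply_zero, consExp_apply_succ]

theorem consExp_zero_zero : consExp 0 0 = 0 := by
  simp [consExp]

theorem exists_eq_consExp (α : ℕ →₀ ℕ) : ∃ b β, α = consExp b β :=
  ⟨α 0, α.comapDomain Nat.succ Nat.succ_injective.injOn, by simp [eq_consExp_iff]⟩

theorem degree_consExp (b : ℕ) (β : ℕ →₀ ℕ) : (consExp b β).degree = b + β.degree := by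
  rw [consExp, map_add, Finsupp.degree_single, Finsupp.degree_mapDomain]

theorem consExp_induction {P : (ℕ →₀ ℕ) → Prop} (zero : P 0)
    (cons : ∀ b β, P β → P (consExp b β)) (α : ℕ →₀ ℕ) : P α := by
  obtain ⟨n, hn⟩ : ∃ n, ∀ k, n ≤ k → α k = 0 := by
    obtain ⟨n, hn⟩ := α.support.exists_nat_subset_range
    refine ⟨n, fun k hk => Finsupp.notMem_support_iff.1 fun hmem => ?_⟩
    exact (Finset.mem_range.1 (hn hmem)).not_ge hk
  induction n generalizing α with
  | zero => rwa [show α = 0 from Finsupp.ext fun k => hn k (Nat.zero_le k)]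
  | succ n ih =>
    obtain ⟨b, β, rfl⟩ := exists_eq_consExp α
    exact cons b β (ih β fun k hk => by simpa using hn (k + 1) (Nat.succ_le_succ hk))

theorem prod_consExp {M : Type*} [CommMonoid M] {f : ℕ → M} (hf : f 0 = 1) (b : ℕ)
    (β : ℕ →₀ ℕ) :
    ((consExp b β).prod fun _ k => f k) = f b * β.prod fun _ k => f k := by
  classical
  have hdisj : Disjoint (Finsupp.single 0 b).support (β.mapDomain Nat.succ).support := by
    refine Finset.disjoint_of_subset_left Finsupp.support_single_subset ?_
    simp [Finsupp.mapDomain_of_notMem_range]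
  rw [consExp, Finsupp.prod_add_index_of_disjoint hdisj, Finsupp.prod_single_index hf,
    Finsupp.prod_mapDomain_index_inj Nat.succ_injective]

/-! ### Reverse plane partitions -/

theorem skewCells_subset_skewCells {lam mu nu : YoungDiagram} (h : mu ≤ nu) :
    skewCells lam nu ⊆ skewCells lam mu :=
  Finset.sdiff_subset_sdiff le_rfl (YoungDiagram.cells_subset_iff.2 h)

theorem mem_skewCells_of_le {lam mu : YoungDiagram} {i i' j j' k l : ℕ} (hi : i ≤ k) (hk : k ≤ i')
    (hj : j ≤ l) (hl : l ≤ j') (h : (i, j) ∈ skewCells lam mu) (h' : (i', j') ∈ skewCells lam mu) :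
    (k, l) ∈ skewCells lam mu := by
  simp only [skewCells, Finset.mem_sdiff, YoungDiagram.mem_cells] at *
  exact ⟨lam.up_left_mem hk hl h'.1, fun hc => h.2 (mu.up_left_mem hi hj hc)⟩

theorem mem_skewCells_inner_of_le {lam mu nu : YoungDiagram} {i i' j j' : ℕ} (hi : i ≤ i')
    (hj : j ≤ j') (h : (i, j) ∈ skewCells lam nu) (h' : (i', j') ∈ skewCells lam mu) :
    (i', j') ∈ skewCells lam nu := by
  simp only [skewCells, Finset.mem_sdiff, YoungDiagram.mem_cells] at *
  exact ⟨h'.1, fun hc => h.2 (nu.up_left_mem hi hj hc)⟩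

namespace ReversePlanePartition

variable {lam mu nu : YoungDiagram}

theorem ext_entry {T T' : ReversePlanePartition lam mu} (h : ∀ i j, T.entry i j = T'.entry i j) :
    T = T' := by
  cases T
  cases T'
  congr
  funext i j
  exact h i j

theorem entry_mono (T : ReversePlanePartition lam mu) {i i' j j' : ℕ} (hi : i ≤ i') (hj : j ≤ j')
    (h : (i, j) ∈ skewCells lam mu) (h' : (i', j') ∈ skewCells lam mu) :
    T.entry i j ≤ T.entry i' j' := by
  have hcorner : (i, j') ∈ skewCells lam mu := mem_skewCells_of_le le_rfl hi hj le_rfl h h'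
  calc T.entry i j ≤ T.entry i j' :=
        hj.eq_or_lt.elim (fun heq => heq ▸ le_rfl) fun hlt => T.row_weak hlt h hcorner
    _ ≤ T.entry i' j' :=
        hi.eq_or_lt.elim (fun heq => heq ▸ le_rfl) fun hlt => T.col_weak hlt hcorner h'

theorem weight_apply (T : ReversePlanePartition lam mu) (k : ℕ) :
    T.weight k =
      (((skewCells lam mu).filter fun c => T.entry c.1 c.2 = k).image Prod.snd).card := by
  rw [weight, Finsupp.finsetSum_apply]
  simp only [Finsupp.single_apply]
  rw [← Finset.card_filter, Finset.filter_image]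
  have hfst : ∀ p ∈ ((skewCells lam mu).filter fun c => T.entry c.1 c.2 = k).image
      (fun c => (T.entry c.1 c.2, c.2)), p.1 = k := by
    simp only [Finset.mem_image, Finset.mem_filter]
    rintro _ ⟨c, hc, rfl⟩
    exact hc.2
  rw [← Finset.card_image_of_injOn (f := Prod.snd) fun p hp q hq h =>
    Prod.ext ((hfst p hp).trans (hfst q hq).symm) h, Finset.image_image]
  rfl

theorem degree_weight (T : ReversePlanePartition lam mu) :
    T.weight.degree = ((skewCells lam mu).image fun c => (T.entry c.1 c.2, c.2)).card := by
  rw [weight, map_sum, Finset.card_eq_sum_ones]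
  exact Finset.sum_congr rfl fun _ _ => Finsupp.degree_single _ _

theorem degree_weight_le (T : ReversePlanePartition lam mu) :
    T.weight.degree ≤ skewSize lam mu :=
  T.degree_weight.trans_le Finset.card_image_le

theorem weight_entry_ne_zero (T : ReversePlanePartition lam mu) {c : ℕ × ℕ}
    (hc : c ∈ skewCells lam mu) : T.weight (T.entry c.1 c.2) ≠ 0 := by
  rw [weight_apply, Finset.card_ne_zero]
  exact ⟨c.2, Finset.mem_image_of_mem _ (Finset.mem_filter.2 ⟨hc, rfl⟩)⟩

instance finite_weight_eq (α : ℕ →₀ ℕ) :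
    Finite {T : ReversePlanePartition lam mu // T.weight = α} := by
  let values : {T : ReversePlanePartition lam mu // T.weight = α} →
      skewCells lam mu → α.support :=
    fun T c => ⟨T.1.entry c.1.1 c.1.2, by
      obtain ⟨T, rfl⟩ := T
      exact Finsupp.mem_support_iff.2 (T.weight_entry_ne_zero c.2)⟩
  refine Finite.of_injective values ?_
  rintro ⟨T, hT⟩ ⟨T', hT'⟩ h
  refine Subtype.ext (ext_entry fun i j => ?_)
  by_cases hc : (i, j) ∈ skewCells lam mu
  · exact congrArg Subtype.val (congrFun h ⟨(i, j), hc⟩)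
  · rw [T.zeros hc, T'.zeros hc]

/-- Raise the entries of a reverse plane partition of shape `λ/ν` by one, and fill `ν/μ`
with zeros. -/
def extend (hmu : mu ≤ nu) (T : ReversePlanePartition lam nu) : ReversePlanePartition lam mu where
  entry i j := if (i, j) ∈ skewCells lam nu then T.entry i j + 1 else 0
  row_weak := by
    intro i j₁ j₂ hj _ hright
    split_ifs with hleft hright'
    · exact Nat.succ_le_succ (T.row_weak hj hleft hright')
    · exact absurd (mem_skewCells_inner_of_le le_rfl hj.le hleft hright) hright'
    · exact Nat.zero_le _
    · exact le_rfl
  col_weak := by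
    intro i₁ i₂ j hi _ hbelow
    split_ifs with habove hbelow'
    · exact Nat.succ_le_succ (T.col_weak hi habove hbelow')
    · exact absurd (mem_skewCells_inner_of_le hi.le le_rfl habove hbelow) hbelow'
    · exact Nat.zero_le _
    · exact le_rfl
  zeros := fun h => if_neg fun h' => h (skewCells_subset_skewCells hmu h')

theorem filter_extend_eq_zero (hmu : mu ≤ nu) (hnu : nu ≤ lam) (T : ReversePlanePartition lam nu) :
    ((skewCells lam mu).filter fun c => (T.extend hmu).entry c.1 c.2 = 0) = skewCells nu mu := by
  ext ⟨i, j⟩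
  simp only [extend, Finset.mem_filter, ite_eq_right_iff, Nat.succ_ne_zero, imp_false, skewCells,
    Finset.mem_sdiff, YoungDiagram.mem_cells]
  have := @hnu (i, j)
  tauto

theorem filter_extend_eq_succ (hmu : mu ≤ nu) (T : ReversePlanePartition lam nu) (k : ℕ) :
    ((skewCells lam mu).filter fun c => (T.extend hmu).entry c.1 c.2 = k + 1) =
      (skewCells lam nu).filter fun c => T.entry c.1 c.2 = k := by
  ext ⟨i, j⟩
  have hsub := @skewCells_subset_skewCells lam _ _ hmu (i, j)
  rw [Finset.mem_filter, Finset.mem_filter]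
  dsimp only [extend]
  split_ifs with hc
  · simp only [hc, hsub hc, Nat.succ_inj]
  · simp only [hc, and_false, false_and]

theorem weight_extend (hmu : mu ≤ nu) (hnu : nu ≤ lam) (T : ReversePlanePartition lam nu) :
    (T.extend hmu).weight = consExp (numColumns nu mu) T.weight := by
  rw [eq_consExp_iff]
  refine ⟨?_, fun k => ?_⟩
  · rw [weight_apply, filter_extend_eq_zero hmu hnu, numColumns]
  · rw [weight_apply, filter_extend_eq_succ, weight_apply]

theorem extend_injective (hmu : mu ≤ nu) :
    Function.Injective (extend hmu : ReversePlanePartition lam nu → _) := by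
  intro T T' h
  refine ext_entry fun i j => ?_
  by_cases hc : (i, j) ∈ skewCells lam nu
  · simpa [extend, hc] using congrArg (fun T => T.entry i j) h
  · rw [T.zeros hc, T'.zeros hc]

/-- The union of `μ` and the boxes with entry `0`. -/
def zeroShape (T : ReversePlanePartition lam mu) : YoungDiagram where
  cells := mu.cells ∪ (skewCells lam mu).filter fun c => T.entry c.1 c.2 = 0
  isLowerSet := by
    rintro ⟨i', j'⟩ ⟨i, j⟩ ⟨hi, hj⟩ h
    simp only [Finset.coe_union, Finset.coe_filter, Set.mem_union, Finset.mem_coe,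
      YoungDiagram.mem_cells, Set.mem_ofPred_eq] at h ⊢
    refine or_iff_not_imp_left.2 fun hmu => ?_
    rcases h with h | ⟨h, hzero⟩
    · exact (hmu (mu.up_left_mem hi hj h)).elim
    · have hc : (i, j) ∈ skewCells lam mu :=
        Finset.mem_sdiff.2 ⟨lam.up_left_mem hi hj (Finset.mem_sdiff.1 h).1, hmu⟩
      exact ⟨hc, Nat.le_zero.1 (hzero ▸ T.entry_mono hi hj hc h)⟩

theorem le_zeroShape (T : ReversePlanePartition lam mu) : mu ≤ T.zeroShape :=
  YoungDiagram.cells_subset_iff.1 Finset.subset_union_left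

theorem zeroShape_le (hle : mu ≤ lam) (T : ReversePlanePartition lam mu) : T.zeroShape ≤ lam :=
  YoungDiagram.cells_subset_iff.1 (Finset.union_subset (YoungDiagram.cells_subset_iff.2 hle)
    ((Finset.filter_subset _ _).trans Finset.sdiff_subset))

theorem mem_skewCells_zeroShape (T : ReversePlanePartition lam mu) {i j : ℕ} :
    (i, j) ∈ skewCells lam T.zeroShape ↔ T.entry i j ≠ 0 := by
  have hzeros := @T.zeros i j
  simp only [skewCells, zeroShape, Finset.mem_sdiff, Finset.mem_union, Finset.mem_filter] at *
  tauto

/-- Lower the nonzero entries by one, forgetting the boxes with entry `0`. -/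
def shrink (T : ReversePlanePartition lam mu) : ReversePlanePartition lam T.zeroShape where
  entry i j := T.entry i j - 1
  row_weak hj h h' := Nat.sub_le_sub_right (T.row_weak hj
    (skewCells_subset_skewCells T.le_zeroShape h)
    (skewCells_subset_skewCells T.le_zeroShape h')) 1
  col_weak hi h h' := Nat.sub_le_sub_right (T.col_weak hi
    (skewCells_subset_skewCells T.le_zeroShape h)
    (skewCells_subset_skewCells T.le_zeroShape h')) 1
  zeros h := by rw [not_not.1 (mt T.mem_skewCells_zeroShape.2 h)]

theorem extend_shrink (T : ReversePlanePartition lam mu) : T.shrink.extend T.le_zeroShape = T := by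
  refine ext_entry fun i j => ?_
  simp only [extend, shrink, T.mem_skewCells_zeroShape]
  split_ifs <;> omega

theorem zeroShape_extend (hmu : mu ≤ nu) (hnu : nu ≤ lam) (T : ReversePlanePartition lam nu) :
    (T.extend hmu).zeroShape = nu := by
  apply YoungDiagram.ext
  change mu.cells ∪ (skewCells lam mu).filter _ = nu.cells
  rw [filter_extend_eq_zero hmu hnu, skewCells,
    Finset.union_sdiff_of_subset (YoungDiagram.cells_subset_iff.2 hmu)]

theorem card_weight_consExp (hle : mu ≤ lam) (b : ℕ) (β : ℕ →₀ ℕ) :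
    Nat.card {T : ReversePlanePartition lam mu // T.weight = consExp b β} =
      ∑ nu ∈ (Finset.Icc mu lam).filter fun nu => numColumns nu mu = b,
        Nat.card {T : ReversePlanePartition lam nu // T.weight = β} := by
  set S := (Finset.Icc mu lam).filter fun nu => numColumns nu mu = b with hS
  have mem_S : ∀ {nu}, nu ∈ S ↔ (mu ≤ nu ∧ nu ≤ lam) ∧ numColumns nu mu = b := by
    simp [hS]
  rw [← Finset.sum_coe_sort, ← Nat.card_sigma]
  symm
  refine Nat.card_congr (Equiv.ofBijective (fun p =>
    ⟨p.2.1.extend (mem_S.1 p.1.2).1.1, ?_⟩) ⟨?_, ?_⟩)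
  · rw [weight_extend _ (mem_S.1 p.1.2).1.2, (mem_S.1 p.1.2).2, p.2.2]
  · rintro ⟨⟨nu, hnu⟩, T, hT⟩ ⟨⟨nu', hnu'⟩, T', hT'⟩ h
    have hext : T.extend (mem_S.1 hnu).1.1 = T'.extend (mem_S.1 hnu').1.1 :=
      congrArg Subtype.val h
    obtain rfl : nu = nu' := by
      rw [← zeroShape_extend (mem_S.1 hnu).1.1 (mem_S.1 hnu).1.2 T, hext,
        zeroShape_extend (mem_S.1 hnu').1.1 (mem_S.1 hnu').1.2 T']
    obtain rfl := extend_injective _ hext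
    rfl
  · rintro ⟨T, hT⟩
    have hweight := hT
    rw [← T.extend_shrink, weight_extend _ (T.zeroShape_le hle), consExp_inj] at hweight
    exact ⟨⟨⟨T.zeroShape, mem_S.2 ⟨⟨T.le_zeroShape, T.zeroShape_le hle⟩, hweight.1⟩⟩,
      T.shrink, hweight.2⟩, Subtype.ext T.extend_shrink⟩

theorem card_weight_zero (hle : mu ≤ lam) :
    Nat.card {T : ReversePlanePartition lam mu // T.weight = 0} = if mu = lam then 1 else 0 := by
  split_ifs with heq
  · subst heq
    have hempty : skewCells mu mu = ∅ := Finset.sdiff_self _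
    rw [Nat.card_eq_one_iff_unique]
    refine ⟨⟨fun T T' => Subtype.ext (ext_entry fun i j => ?_)⟩,
      ⟨⟨fun _ _ => 0, fun _ _ _ => le_rfl, fun _ _ _ => le_rfl, fun _ => rfl⟩, ?_⟩⟩
    · rw [T.1.zeros (by simp [hempty]), T'.1.zeros (by simp [hempty])]
    · simp [weight, hempty]
  · rw [Nat.card_eq_zero]
    refine Or.inl ⟨fun T => ?_⟩
    obtain ⟨c, hc⟩ : (skewCells lam mu).Nonempty := by
      rw [skewCells, Finset.sdiff_nonempty, YoungDiagram.cells_subset_iff]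
      exact fun h => heq (hle.antisymm h)
    exact T.1.weight_entry_ne_zero hc (DFunLike.congr_fun T.2 _)

end ReversePlanePartition

/-! ### Symmetry of the dual stable Grothendieck polynomials -/

section DualG

variable {K : Type*} [CommRing K]

theorem coeff_dualG (lam mu : YoungDiagram) (α : ℕ →₀ ℕ) :
    MvPowerSeries.coeff α (dualG K lam mu) =
      (Nat.card {T : ReversePlanePartition lam mu // T.weight = α} : K) := rfl

theorem degree_le_of_coeff_dualG_ne_zero {lam mu : YoungDiagram} {α : ℕ →₀ ℕ}
    (h : MvPowerSeries.coeff α (dualG K lam mu) ≠ 0) : α.degree ≤ skewSize lam mu := by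
  have hcard : Nat.card {T : ReversePlanePartition lam mu // T.weight = α} ≠ 0 := fun hzero =>
    h (by rw [coeff_dualG, hzero, Nat.cast_zero])
  obtain ⟨⟨T, rfl⟩⟩ := (Nat.card_ne_zero.1 hcard).1
  exact T.degree_weight_le

/-- The coefficients of `x^α` in all `g_{λ/μ}`, as an element of the incidence algebra of Young's
lattice. -/
def dualGCoeff (K : Type*) [CommRing K] (α : ℕ →₀ ℕ) : IncidenceAlgebra K YoungDiagram :=
  incidenceElement fun mu lam => MvPowerSeries.coeff α (dualG K lam mu)

theorem dualGCoeff_apply (α : ℕ →₀ ℕ) {mu lam : YoungDiagram} (h : mu ≤ lam) :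
    dualGCoeff K α mu lam = MvPowerSeries.coeff α (dualG K lam mu) :=
  incidenceElement_apply _ h

theorem dualGCoeff_zero : dualGCoeff K 0 = 1 := by
  ext mu lam h
  rw [dualGCoeff_apply 0 h, coeff_dualG, ReversePlanePartition.card_weight_zero h,
    IncidenceAlgebra.one_apply, Nat.cast_ite, Nat.cast_one, Nat.cast_zero]

theorem dualGCoeff_consExp (b : ℕ) (β : ℕ →₀ ℕ) :
    dualGCoeff K (consExp b β) = columnIndicator K b * dualGCoeff K β := by
  ext mu lam h
  rw [dualGCoeff_apply _ h, coeff_dualG, ReversePlanePartition.card_weight_consExp h, dualGCoeff,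
    columnIndicator, incidenceElement_mul_apply, Nat.cast_sum, Finset.sum_filter]
  simp only [coeff_dualG, ite_mul, one_mul, zero_mul]

theorem columnIndicator_dualGCoeff_comm (b : ℕ) (α : ℕ →₀ ℕ) :
    Commute (columnIndicator K b) (dualGCoeff K α) := by
  induction α using consExp_induction with
  | zero => exact dualGCoeff_zero (K := K) ▸ Commute.one_right _
  | cons b' β ih =>
    exact dualGCoeff_consExp (K := K) b' β ▸ (columnIndicator_comm b b').mul_right ih

open scoped IsMulCommutative in
theorem dualGCoeff_mapDomain (σ : Equiv.Perm ℕ) (α : ℕ →₀ ℕ) :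
    dualGCoeff K (α.mapDomain σ) = dualGCoeff K α := by
  let A := Subring.closure (Set.range (columnIndicator K))
  have : IsMulCommutative A := by
    refine Subring.isMulCommutative_closure ?_
    rintro _ ⟨a, rfl⟩ _ ⟨b, rfl⟩
    exact columnIndicator_comm a b
  let D : ℕ → A := fun b => ⟨columnIndicator K b, Subring.subset_closure ⟨b, rfl⟩⟩
  have hD : D 0 = 1 := Subtype.ext columnIndicator_zero
  have eq_prod : ∀ α : ℕ →₀ ℕ, dualGCoeff K α = (α.prod fun _ b => D b : A) := by
    intro α
    induction α using consExp_induction with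
    | zero => rw [dualGCoeff_zero, Finsupp.prod_zero_index]; rfl
    | cons b β ih => rw [dualGCoeff_consExp, prod_consExp hD, ih]; rfl
  rw [eq_prod, eq_prod, Finsupp.prod_mapDomain_index_inj σ.injective]

theorem dualG_mem_symFun {lam mu : YoungDiagram} (h : mu ≤ lam) : dualG K lam mu ∈ SymFun K := by
  refine ⟨mem_symSeries_iff.2 fun σ α => ?_, skewSize lam mu,
    fun α => degree_le_of_coeff_dualG_ne_zero⟩
  rw [← dualGCoeff_apply _ h, ← dualGCoeff_apply _ h, dualGCoeff_mapDomain]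

end DualG

/-! ### Specializing the first variable of a symmetric function -/

section Specialize

variable {K : Type*} [CommRing K]

theorem coeff_mapDomain_eq {f : MvPowerSeries ℕ K} (hf : f ∈ SymSeries K) {ι : Type*}
    (γ : ι →₀ ℕ) {u v : ι → ℕ} (hu : Function.Injective u) (hv : Function.Injective v) :
    MvPowerSeries.coeff (γ.mapDomain u) f = MvPowerSeries.coeff (γ.mapDomain v) f := by
  obtain ⟨σ, hσ⟩ := Equiv.Perm.exists_extending_pair (fun i : γ.support => u i)
    (fun i : γ.support => v i) (hu.comp Subtype.val_injective) (hv.comp Subtype.val_injective)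
  rw [← mem_symSeries_iff.1 hf σ, ← Finsupp.mapDomain_comp]
  congr 2
  exact Finsupp.mapDomain_congr fun i hi => hσ ⟨i, hi⟩

theorem coeff_single_add_mapDomain_eq {f : MvPowerSeries ℕ K} (hf : f ∈ SymSeries K) {ι : Type*}
    (b : ℕ) (γ : ι →₀ ℕ) {u v : ι → ℕ} {k l : ℕ} (hu : Function.Injective u)
    (hv : Function.Injective v) (hk : ∀ i, u i ≠ k) (hl : ∀ i, v i ≠ l) :
    MvPowerSeries.coeff (Finsupp.single k b + γ.mapDomain u) f =
      MvPowerSeries.coeff (Finsupp.single l b + γ.mapDomain v) f := by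
  have extend_eq : ∀ (w : ι → ℕ) (m : ℕ), Finsupp.single m b + γ.mapDomain w =
      (Finsupp.single none b + γ.mapDomain some).mapDomain (fun o : Option ι => o.elim m w) := by
    intro w m
    rw [Finsupp.mapDomain_add, Finsupp.mapDomain_single, ← Finsupp.mapDomain_comp]
    rfl
  have extend_injective : ∀ (w : ι → ℕ) (m : ℕ), Function.Injective w → (∀ i, w i ≠ m) →
      Function.Injective (fun o : Option ι => o.elim m w) := by
    rintro w m hw hm (_ | i) (_ | j) h
    · rfl
    · exact (hm j h.symm).elim
    · exact (hm i h).elim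
    · exact congrArg some (hw h)
  rw [extend_eq, extend_eq]
  exact coeff_mapDomain_eq hf _ (extend_injective u k hu hk)
    (extend_injective v l hv hl)

theorem consExp_eq_zero {b : ℕ} {β : ℕ →₀ ℕ} : consExp b β = 0 ↔ b = 0 ∧ β = 0 :=
  ⟨fun h => consExp_inj.1 (h.trans consExp_zero_zero.symm),
    fun h => by rw [h.1, h.2, consExp_zero_zero]⟩

theorem consExp_add (a b : ℕ) (α β : ℕ →₀ ℕ) :
    consExp (a + b) (α + β) = consExp a α + consExp b β := by
  simp only [consExp, Finsupp.single_add, Finsupp.mapDomain_add]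
  abel

/-- The coefficient of `x^β` in `f(X, x 0, x 1, …)`, as a polynomial in `X`. -/
def slice (f : MvPowerSeries ℕ K) (β : ℕ →₀ ℕ) : Polynomial K :=
  ∑ᶠ b, Polynomial.monomial b (MvPowerSeries.coeff (consExp b β) f)

/-- `N` bounds the degrees of the monomials of `f`. -/
def IsDegreeBound (N : ℕ) (f : MvPowerSeries ℕ K) : Prop :=
  ∀ α : ℕ →₀ ℕ, MvPowerSeries.coeff α f ≠ 0 → α.degree ≤ N

theorem IsDegreeBound.mono {M N : ℕ} {f : MvPowerSeries ℕ K} (h : IsDegreeBound M f)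
    (hMN : M ≤ N) : IsDegreeBound N f := fun α hα => (h α hα).trans hMN

theorem slice_eq_sum {N : ℕ} {f : MvPowerSeries ℕ K} (hN : IsDegreeBound N f) (β : ℕ →₀ ℕ) :
    slice f β = ∑ b ∈ Finset.range (N + 1),
      Polynomial.monomial b (MvPowerSeries.coeff (consExp b β) f) := by
  refine finsum_eq_sum_of_support_subset _ fun b hb => ?_
  rw [Function.mem_support, Ne, Polynomial.monomial_eq_zero_iff] at hb
  have hdeg := hN _ hb
  rw [degree_consExp] at hdeg
  rw [Finset.coe_range, Set.mem_Iio]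
  omega

theorem coeff_slice {f : MvPowerSeries ℕ K} (hf : f ∈ BoundedSeries K) (β : ℕ →₀ ℕ) (b : ℕ) :
    (slice f β).coeff b = MvPowerSeries.coeff (consExp b β) f := by
  obtain ⟨N, hN⟩ := hf
  rw [slice_eq_sum hN, Polynomial.finsetSum_coeff]
  simp only [Polynomial.coeff_monomial]
  rw [Finset.sum_ite_eq' (Finset.range (N + 1)) b]
  split_ifs with h
  · rfl
  · by_contra hne
    have hdeg := hN _ (Ne.symm hne)
    rw [degree_consExp] at hdeg
    rw [Finset.mem_range] at h
    omega

theorem slice_add {f g : MvPowerSeries ℕ K} (hf : f ∈ BoundedSeries K) (hg : g ∈ BoundedSeries K)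
    (β : ℕ →₀ ℕ) : slice (f + g) β = slice f β + slice g β := by
  ext b
  rw [Polynomial.coeff_add, coeff_slice (add_mem hf hg), coeff_slice hf, coeff_slice hg, map_add]

theorem slice_smul (c : K) {f : MvPowerSeries ℕ K} (hf : f ∈ BoundedSeries K) (β : ℕ →₀ ℕ) :
    slice (c • f) β = c • slice f β := by
  ext b
  rw [Polynomial.coeff_smul, coeff_slice (Subalgebra.smul_mem _ hf c), coeff_slice hf,
    MvPowerSeries.coeff_smul, smul_eq_mul]

theorem slice_one (β : ℕ →₀ ℕ) :
    slice (1 : MvPowerSeries ℕ K) β = Polynomial.C (MvPowerSeries.coeff β 1) := by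
  classical
  ext b
  simp only [coeff_slice (one_mem _), MvPowerSeries.coeff_one, Polynomial.coeff_C,
    consExp_eq_zero, ite_and]

theorem slice_mul {f g : MvPowerSeries ℕ K} (hf : f ∈ BoundedSeries K) (hg : g ∈ BoundedSeries K)
    (β : ℕ →₀ ℕ) :
    slice (f * g) β = ∑ p ∈ Finset.HasAntidiagonal.antidiagonal β, slice f p.1 * slice g p.2 := by
  classical
  ext b
  rw [coeff_slice (mul_mem hf hg), MvPowerSeries.coeff_mul, Polynomial.finsetSum_coeff]
  simp only [Polynomial.coeff_mul, coeff_slice hf, coeff_slice hg]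
  rw [← Finset.sum_product']
  symm
  refine Finset.sum_bij (fun p _ => (consExp p.2.1 p.1.1, consExp p.2.2 p.1.2)) ?_ ?_ ?_ ?_
  · rintro ⟨⟨α, α'⟩, a, a'⟩ h
    simp only [Finset.mem_product, Finset.HasAntidiagonal.mem_antidiagonal] at h ⊢
    rw [← consExp_add, h.1, h.2]
  · rintro ⟨⟨α, α'⟩, a, a'⟩ - ⟨⟨α₁, α₁'⟩, a₁, a₁'⟩ - h
    simp only [Prod.mk.injEq, consExp_inj] at h ⊢
    tauto
  · rintro ⟨α, α'⟩ h
    obtain ⟨a, γ, rfl⟩ := exists_eq_consExp α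
    obtain ⟨a', γ', rfl⟩ := exists_eq_consExp α'
    rw [Finset.HasAntidiagonal.mem_antidiagonal, ← consExp_add, consExp_inj] at h
    exact ⟨((γ, γ'), (a, a')), by simpa [Finset.mem_product, and_comm] using h, rfl⟩
  · intros
    rfl

/-- The series `f(s, x 0, x 1, …)`. -/
def specializeSeries (s : K) (f : MvPowerSeries ℕ K) : MvPowerSeries ℕ K :=
  fun β => (slice f β).eval s

theorem specializeSeries_mem (s : K) {f : MvPowerSeries ℕ K} (hf : f ∈ SymFun K) :
    specializeSeries s f ∈ SymFun K := by
  have hb : f ∈ BoundedSeries K := hf.2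
  constructor
  · rw [SetLike.mem_coe, mem_symSeries_iff]
    intro σ β
    change (slice f (β.mapDomain σ)).eval s = (slice f β).eval s
    congr 1
    ext b
    rw [coeff_slice hb, coeff_slice hb, consExp, consExp, ← Finsupp.mapDomain_comp]
    exact coeff_single_add_mapDomain_eq hf.1 b β (Nat.succ_injective.comp σ.injective)
      Nat.succ_injective (fun i => Nat.succ_ne_zero _) (fun i => Nat.succ_ne_zero _)
  · obtain ⟨N, hN⟩ := hf.2
    refine ⟨N, fun β hβ => ?_⟩
    have slice_ne_zero : slice f β ≠ 0 := fun h => hβ <| by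
      change (slice f β).eval s = 0
      rw [h, Polynomial.eval_zero]
    obtain ⟨b, hcoeff⟩ : ∃ b, (slice f β).coeff b ≠ 0 := by
      by_contra! h
      exact slice_ne_zero (Polynomial.ext h)
    rw [coeff_slice hb] at hcoeff
    have hdeg := hN _ hcoeff
    rw [degree_consExp] at hdeg
    omega

theorem specializeSeries_mul (s : K) {f g : MvPowerSeries ℕ K} (hf : f ∈ BoundedSeries K)
    (hg : g ∈ BoundedSeries K) :
    specializeSeries s (f * g) = specializeSeries s f * specializeSeries s g := by
  classical
  ext β
  change (slice (f * g) β).eval s = _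
  rw [slice_mul hf hg, MvPowerSeries.coeff_mul, Polynomial.eval_finsetSum]
  exact Finset.sum_congr rfl fun p _ => Polynomial.eval_mul

/-- The algebra homomorphism `f ↦ f(s, x 0, x 1, …)` of `Λ`. With `s = -t` it turns out to be
inverse to `E(t)^⊥`. -/
def specialize (s : K) : SymFun K →ₐ[K] SymFun K :=
  AlgHom.ofLinearMap
    { toFun f := ⟨specializeSeries s f, specializeSeries_mem s f.2⟩
      map_add' f g := Subtype.ext <| funext fun β =>
        (congrArg (Polynomial.eval s) (slice_add f.2.2 g.2.2 β)).trans Polynomial.eval_add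
      map_smul' c f := Subtype.ext <| funext fun β =>
        (congrArg (Polynomial.eval s) (slice_smul c f.2.2 β)).trans (Polynomial.eval_smul ..) }
    (Subtype.ext <| funext fun β =>
      (congrArg (Polynomial.eval s) (slice_one β)).trans Polynomial.eval_C)
    (fun f g => Subtype.ext (specializeSeries_mul s f.2.2 g.2.2))

theorem coeff_specialize (s : K) {N : ℕ} {f : SymFun K}
    (hN : IsDegreeBound N (f : MvPowerSeries ℕ K)) (β : ℕ →₀ ℕ) :
    MvPowerSeries.coeff β (specialize s f : MvPowerSeries ℕ K) = ∑ b ∈ Finset.range (N + 1),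
      s ^ b * MvPowerSeries.coeff (consExp b β) (f : MvPowerSeries ℕ K) := by
  change (slice (f : MvPowerSeries ℕ K) β).eval s = _
  rw [slice_eq_sum hN, Polynomial.eval_finsetSum]
  exact Finset.sum_congr rfl fun b _ => by rw [Polynomial.eval_monomial, mul_comm]

/-! ### Specialization and the comultiplication -/

/-- The coefficient of `y^β` in `f(x, y)`, as a symmetric function of `x`. -/
def symCoeff (f : SymFun K) (β : ℕ →₀ ℕ) : SymFun K :=
  ⟨yCoeff (f : MvPowerSeries ℕ K) β, yCoeff_mem f β⟩

theorem coeff_symCoeff (f : SymFun K) (α β : ℕ →₀ ℕ) :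
    MvPowerSeries.coeff α (symCoeff f β : MvPowerSeries ℕ K) = MvPowerSeries.coeff
      ((Finsupp.sumElim α β).mapDomain Equiv.natSumNatEquivNat) (f : MvPowerSeries ℕ K) :=
  coeff_yCoeff _ α β

theorem coeff_perp (F : SymSeries K) (f : SymFun K) (β : ℕ →₀ ℕ) :
    MvPowerSeries.coeff β (perp F f : MvPowerSeries ℕ K) = hall F (symCoeff f β) := rfl

theorem isDegreeBound_symCoeff {N : ℕ} {f : SymFun K}
    (hN : IsDegreeBound N (f : MvPowerSeries ℕ K)) (β : ℕ →₀ ℕ) :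
    IsDegreeBound N (symCoeff f β : MvPowerSeries ℕ K) := by
  intro α h
  rw [coeff_symCoeff] at h
  have hdeg := hN _ h
  rw [degree_sumElim] at hdeg
  omega

theorem mapDomain_sumElim {ι : Type*} (w : ℕ ⊕ ℕ → ι) (α β : ℕ →₀ ℕ) :
    (Finsupp.sumElim α β).mapDomain w = α.mapDomain (w ∘ Sum.inl) + β.mapDomain (w ∘ Sum.inr) := by
  rw [Finsupp.sumElim_eq_add, Finsupp.mapDomain_add, ← Finsupp.mapDomain_comp,
    ← Finsupp.mapDomain_comp]

theorem coeff_consExp_sumElim (f : SymFun K) (b : ℕ) (α β : ℕ →₀ ℕ) :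
    MvPowerSeries.coeff (consExp b ((Finsupp.sumElim α β).mapDomain Equiv.natSumNatEquivNat))
        (f : MvPowerSeries ℕ K) =
      MvPowerSeries.coeff α (symCoeff f (consExp b β) : MvPowerSeries ℕ K) := by
  have mapDomain_eq : (Finsupp.sumElim α (consExp b β)).mapDomain Equiv.natSumNatEquivNat =
      Finsupp.single (Equiv.natSumNatEquivNat (Sum.inr 0)) b + (Finsupp.sumElim α β).mapDomain
        (Equiv.natSumNatEquivNat ∘ Sum.map id Nat.succ) := by
    rw [mapDomain_sumElim, mapDomain_sumElim, consExp, Finsupp.mapDomain_add,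
      Finsupp.mapDomain_single, ← Finsupp.mapDomain_comp, add_left_comm]
    rfl
  rw [coeff_symCoeff, mapDomain_eq, consExp, ← Finsupp.mapDomain_comp]
  refine coeff_single_add_mapDomain_eq f.2.1 b _
    (Nat.succ_injective.comp Equiv.natSumNatEquivNat.injective)
    (Equiv.natSumNatEquivNat.injective.comp
      (Sum.map_injective.2 ⟨Function.injective_id, Nat.succ_injective⟩))
    (fun i => Nat.succ_ne_zero _) (fun i h => ?_)
  rcases i with i | i <;> simpa using Equiv.natSumNatEquivNat.injective h

theorem coeff_consExp_symCoeff (f : SymFun K) (b : ℕ) (α β : ℕ →₀ ℕ) :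
    MvPowerSeries.coeff (consExp b α) (symCoeff f β : MvPowerSeries ℕ K) =
      MvPowerSeries.coeff (consExp b ((Finsupp.sumElim α β).mapDomain Equiv.natSumNatEquivNat))
        (f : MvPowerSeries ℕ K) := by
  have mapDomain_eq : (Finsupp.sumElim (consExp b α) β).mapDomain Equiv.natSumNatEquivNat =
      Finsupp.single (Equiv.natSumNatEquivNat (Sum.inl 0)) b + (Finsupp.sumElim α β).mapDomain
        (Equiv.natSumNatEquivNat ∘ Sum.map Nat.succ id) := by
    rw [mapDomain_sumElim, mapDomain_sumElim, consExp, Finsupp.mapDomain_add,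
      Finsupp.mapDomain_single, ← Finsupp.mapDomain_comp, add_assoc]
    rfl
  rw [coeff_symCoeff, mapDomain_eq, consExp, ← Finsupp.mapDomain_comp]
  refine coeff_single_add_mapDomain_eq f.2.1 b _
    (Equiv.natSumNatEquivNat.injective.comp
      (Sum.map_injective.2 ⟨Nat.succ_injective, Function.injective_id⟩))
    (Nat.succ_injective.comp Equiv.natSumNatEquivNat.injective)
    (fun i h => ?_) (fun i => Nat.succ_ne_zero _)
  rcases i with i | i <;> simpa using Equiv.natSumNatEquivNat.injective h

theorem coeff_zero_symCoeff (f : SymFun K) (β : ℕ →₀ ℕ) :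
    MvPowerSeries.coeff 0 (symCoeff f β : MvPowerSeries ℕ K) =
      MvPowerSeries.coeff β (f : MvPowerSeries ℕ K) := by
  rw [coeff_symCoeff, mapDomain_sumElim, Finsupp.mapDomain_zero, zero_add]
  conv_rhs => rw [← Finsupp.mapDomain_id (v := β)]
  exact coeff_mapDomain_eq f.2.1 β (Equiv.natSumNatEquivNat.injective.comp Sum.inr_injective)
    Function.injective_id

theorem symCoeff_specialize (s : K) (f : SymFun K) (β : ℕ →₀ ℕ) :
    symCoeff (specialize s f) β = specialize s (symCoeff f β) := by
  obtain ⟨N, hN⟩ := f.2.2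
  ext α
  rw [coeff_symCoeff, coeff_specialize s hN, coeff_specialize s (isDegreeBound_symCoeff hN β)]
  exact Finset.sum_congr rfl fun b _ => by rw [coeff_consExp_symCoeff]

theorem symCoeff_specialize_eq_sum (s : K) {N : ℕ} {f : SymFun K}
    (hN : IsDegreeBound N (f : MvPowerSeries ℕ K)) (β : ℕ →₀ ℕ) :
    symCoeff (specialize s f) β =
      ∑ b ∈ Finset.range (N + 1), s ^ b • symCoeff f (consExp b β) := by
  ext α
  rw [coeff_symCoeff, coeff_specialize s hN, AddSubmonoidClass.coe_finsetSum, map_sum]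
  refine Finset.sum_congr rfl fun b _ => ?_
  rw [coeff_consExp_sumElim]
  rfl

end Specialize

/-! ### Schur functions as leading terms of dual stable Grothendieck polynomials -/

section Schur

variable {K : Type*} [CommRing K]

theorem skewCells_bot (lam : YoungDiagram) : skewCells lam ⊥ = lam.cells := by
  rw [skewCells, YoungDiagram.cells_bot, Finset.sdiff_empty]

theorem skewSize_bot (lam : YoungDiagram) : skewSize lam ⊥ = lam.card := by
  rw [skewSize, skewCells_bot]

theorem skewSize_add_card {lam mu : YoungDiagram} (h : mu ≤ lam) :
    skewSize lam mu + mu.card = lam.card :=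
  Finset.card_sdiff_add_card_eq_card (YoungDiagram.cells_subset_iff.2 h)

theorem numColumns_le_skewSize (lam mu : YoungDiagram) : numColumns lam mu ≤ skewSize lam mu :=
  Finset.card_image_le

theorem degree_tableauWeight {lam : YoungDiagram} (T : SemistandardYoungTableau lam) :
    (tableauWeight T).degree = lam.card := by
  rw [tableauWeight, map_sum]
  simp [YoungDiagram.card]

theorem injOn_entry_column {lam : YoungDiagram} (T : SemistandardYoungTableau lam) :
    Set.InjOn (fun c : ℕ × ℕ => (T c.1 c.2, c.2)) lam.cells := by
  rintro ⟨i, j⟩ hc ⟨i', j'⟩ hc' heq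
  simp only [Prod.mk.injEq, Finset.mem_coe, YoungDiagram.mem_cells] at heq hc hc'
  obtain ⟨hentry, rfl⟩ := heq
  rcases lt_trichotomy i i' with hi | rfl | hi
  · exact absurd hentry (T.col_strict hi hc').ne
  · rfl
  · exact absurd hentry (T.col_strict hi hc).ne'

/-- A semistandard tableau, regarded as a reverse plane partition. These are the reverse plane
partitions whose weight has the largest possible degree. -/
def toReversePlanePartition {lam : YoungDiagram} (T : SemistandardYoungTableau lam) :
    ReversePlanePartition lam ⊥ where
  entry i j := T i j
  row_weak hj _ h := T.row_weak hj (by rwa [skewCells_bot] at h)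
  col_weak hi _ h := (T.col_strict hi (by rwa [skewCells_bot] at h)).le
  zeros h := T.zeros (by rwa [skewCells_bot] at h)

theorem weight_toReversePlanePartition {lam : YoungDiagram} (T : SemistandardYoungTableau lam) :
    (toReversePlanePartition T).weight = tableauWeight T := by
  rw [ReversePlanePartition.weight, skewCells_bot, tableauWeight]
  exact Finset.sum_image (injOn_entry_column T)

theorem exists_toReversePlanePartition_eq {lam : YoungDiagram} (T : ReversePlanePartition lam ⊥)
    (h : T.weight.degree = lam.card) :
    ∃ T' : SemistandardYoungTableau lam, toReversePlanePartition T' = T := by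
  rw [ReversePlanePartition.degree_weight, skewCells_bot, YoungDiagram.card,
    Finset.card_image_iff] at h
  refine ⟨⟨fun i j => T.entry i j, ?_, ?_, ?_⟩, rfl⟩
  · intro i j₁ j₂ hj hc
    refine T.row_weak hj ?_ (by rwa [skewCells_bot])
    rw [skewCells_bot]
    exact lam.up_left_mem le_rfl hj.le hc
  · intro i₁ i₂ j hi hc
    have hc₁ : (i₁, j) ∈ lam := lam.up_left_mem hi.le le_rfl hc
    refine lt_of_le_of_ne (T.col_weak hi (by rwa [skewCells_bot]) (by rwa [skewCells_bot])) ?_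
    intro heq
    exact hi.ne (congrArg Prod.fst (h (x₁ := (i₁, j)) hc₁ (x₂ := (i₂, j)) hc (by simp [heq])))
  · intro i j hc
    exact T.zeros (by rwa [skewCells_bot])

theorem coeff_schur (lam : YoungDiagram) (α : ℕ →₀ ℕ) :
    MvPowerSeries.coeff α (schur K lam) =
      (Nat.card {T : SemistandardYoungTableau lam // tableauWeight T = α} : K) := rfl

theorem coeff_schur_eq_coeff_dualG {lam : YoungDiagram} {α : ℕ →₀ ℕ} (h : α.degree = lam.card) :
    MvPowerSeries.coeff α (schur K lam) = MvPowerSeries.coeff α (dualG K lam ⊥) := by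
  rw [coeff_schur, coeff_dualG]
  congr 1
  refine Nat.card_congr (Equiv.ofBijective
    (fun T => ⟨toReversePlanePartition T.1, (weight_toReversePlanePartition T.1).trans T.2⟩)
    ⟨?_, ?_⟩)
  · rintro ⟨T, hT⟩ ⟨T', hT'⟩ heq
    refine Subtype.ext (SemistandardYoungTableau.ext fun i j => ?_)
    exact congrArg (fun S => S.1.entry i j) heq
  · rintro ⟨T, rfl⟩
    obtain ⟨T', rfl⟩ := exists_toReversePlanePartition_eq T h
    exact ⟨⟨T', (weight_toReversePlanePartition T').symm⟩, rfl⟩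

theorem exists_tableau_of_coeff_schur_ne_zero {lam : YoungDiagram} {α : ℕ →₀ ℕ}
    (h : MvPowerSeries.coeff α (schur K lam) ≠ 0) :
    ∃ T : SemistandardYoungTableau lam, tableauWeight T = α := by
  by_contra hne
  have : IsEmpty {T : SemistandardYoungTableau lam // tableauWeight T = α} :=
    ⟨fun T => hne ⟨T.1, T.2⟩⟩
  exact h (by rw [coeff_schur, Nat.card_of_isEmpty, Nat.cast_zero])

theorem degree_eq_of_coeff_schur_ne_zero {lam : YoungDiagram} {α : ℕ →₀ ℕ}
    (h : MvPowerSeries.coeff α (schur K lam) ≠ 0) : α.degree = lam.card := by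
  obtain ⟨T, rfl⟩ := exists_tableau_of_coeff_schur_ne_zero h
  exact degree_tableauWeight T

theorem coeff_schur_eq_zero_of_degree_ne {lam : YoungDiagram} {α : ℕ →₀ ℕ}
    (h : α.degree ≠ lam.card) : MvPowerSeries.coeff α (schur K lam) = 0 :=
  of_not_not fun hne => h (degree_eq_of_coeff_schur_ne_zero hne)

theorem coeff_schur_eq_ite (lam : YoungDiagram) (α : ℕ →₀ ℕ) :
    MvPowerSeries.coeff α (schur K lam) =
      if α.degree = lam.card then dualGCoeff K α ⊥ lam else 0 := by
  split_ifs with h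
  · rw [coeff_schur_eq_coeff_dualG h, dualGCoeff_apply _ bot_le]
  · exact coeff_schur_eq_zero_of_degree_ne h

theorem isDegreeBound_schur (lam : YoungDiagram) : IsDegreeBound lam.card (schur K lam) :=
  fun _ hα => (degree_eq_of_coeff_schur_ne_zero hα).le

theorem schur_mem_symFun (lam : YoungDiagram) : schur K lam ∈ SymFun K := by
  refine ⟨?_, lam.card, isDegreeBound_schur lam⟩
  rw [SetLike.mem_coe, mem_symSeries_iff]
  intro σ α
  rw [coeff_schur_eq_ite, coeff_schur_eq_ite, dualGCoeff_mapDomain, Finsupp.degree_mapDomain]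

/-- The Schur function as an element of `Λ`. -/
def schurSym (K : Type*) [CommRing K] (lam : YoungDiagram) : SymFun K :=
  ⟨schur K lam, schur_mem_symFun lam⟩

/-- The exponent vector `(λ 0, λ 1, …)` of a partition, for evaluating symmetric series at one
monomial per orbit; it is the weight of the tableau with all entries `i` in row `i`. -/
def rowContent (lam : YoungDiagram) : ℕ →₀ ℕ :=
  tableauWeight (SemistandardYoungTableau.highestWeight lam)

theorem tableauWeight_apply {lam : YoungDiagram} (T : SemistandardYoungTableau lam) (k : ℕ) :
    tableauWeight T k = (lam.cells.filter fun c => T c.1 c.2 = k).card := by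
  rw [tableauWeight, Finsupp.finsetSum_apply, Finset.card_filter]
  exact Finset.sum_congr rfl fun c _ => Finsupp.single_apply

theorem rowContent_apply (lam : YoungDiagram) (k : ℕ) : rowContent lam k = lam.rowLen k := by
  rw [rowContent, tableauWeight_apply, YoungDiagram.rowLen_eq_card, YoungDiagram.row]
  congr 1
  refine Finset.filter_congr fun c hc => ?_
  rw [SemistandardYoungTableau.highestWeight_apply, if_pos (by simpa using hc)]

theorem rowContent_injective : Function.Injective rowContent := by
  intro lam mu h
  ext ⟨i, j⟩
  rw [YoungDiagram.mem_cells, YoungDiagram.mem_cells, YoungDiagram.mem_iff_lt_rowLen,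
    YoungDiagram.mem_iff_lt_rowLen, ← rowContent_apply, ← rowContent_apply, h]

theorem degree_rowContent (lam : YoungDiagram) : (rowContent lam).degree = lam.card :=
  degree_tableauWeight _

/-- The sum of the row indices of the boxes, usually denoted `n(λ)`. The matrix of Kostka numbers
is unitriangular with respect to it. -/
def rowIndexSum (lam : YoungDiagram) : ℕ := ∑ c ∈ lam.cells, c.1

theorem linearCombination_tableauWeight {lam : YoungDiagram} (T : SemistandardYoungTableau lam) :
    Finsupp.linearCombination ℕ (id : ℕ → ℕ) (tableauWeight T) = ∑ c ∈ lam.cells, T c.1 c.2 := by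
  rw [tableauWeight, map_sum]
  simp

theorem linearCombination_rowContent (lam : YoungDiagram) :
    Finsupp.linearCombination ℕ (id : ℕ → ℕ) (rowContent lam) = rowIndexSum lam := by
  rw [rowContent, linearCombination_tableauWeight]
  refine Finset.sum_congr rfl fun c hc => ?_
  rw [SemistandardYoungTableau.highestWeight_apply, if_pos (by simpa using hc)]

theorem row_index_le_entry {lam : YoungDiagram} (T : SemistandardYoungTableau lam) (i j : ℕ)
    (h : (i, j) ∈ lam) : i ≤ T i j := by
  induction i with
  | zero => exact Nat.zero_le _
  | succ i ih =>
    exact Nat.succ_le_of_lt ((ih (lam.up_left_mem (Nat.le_succ i) le_rfl h)).trans_lt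
      (T.col_strict (Nat.lt_succ_self i) h))

theorem rowIndexSum_le_of_weight_eq {lam mu : YoungDiagram} (T : SemistandardYoungTableau lam)
    (h : tableauWeight T = rowContent mu) : rowIndexSum lam ≤ rowIndexSum mu := by
  rw [← linearCombination_rowContent mu, ← h, linearCombination_tableauWeight]
  exact Finset.sum_le_sum fun c hc => row_index_le_entry T c.1 c.2 hc

theorem eq_highestWeight_of_weight_eq {lam mu : YoungDiagram} (T : SemistandardYoungTableau lam)
    (h : tableauWeight T = rowContent mu) (hle : rowIndexSum mu ≤ rowIndexSum lam) :
    T = SemistandardYoungTableau.highestWeight lam := by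
  have hsum : ∑ c ∈ lam.cells, c.1 = ∑ c ∈ lam.cells, T c.1 c.2 := by
    rw [← linearCombination_tableauWeight, h, linearCombination_rowContent]
    exact le_antisymm (rowIndexSum_le_of_weight_eq T h) hle
  have heq := (Finset.sum_eq_sum_iff_of_le fun c hc => row_index_le_entry T c.1 c.2 hc).1 hsum
  ext i j
  rw [SemistandardYoungTableau.highestWeight_apply]
  split_ifs with hc
  · exact (heq (i, j) hc).symm
  · exact T.zeros hc

theorem coeff_rowContent_schur_self (lam : YoungDiagram) :
    MvPowerSeries.coeff (rowContent lam) (schur K lam) = 1 := by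
  rw [coeff_schur, Nat.card_eq_one_iff_unique.2, Nat.cast_one]
  refine ⟨⟨fun T T' => Subtype.ext ?_⟩,
    ⟨SemistandardYoungTableau.highestWeight lam, rfl⟩⟩
  rw [eq_highestWeight_of_weight_eq T.1 T.2 le_rfl,
    eq_highestWeight_of_weight_eq T'.1 T'.2 le_rfl]

theorem coeff_rowContent_schur_eq_zero {lam mu : YoungDiagram} (hne : lam ≠ mu)
    (hle : rowIndexSum mu ≤ rowIndexSum lam) :
    MvPowerSeries.coeff (rowContent mu) (schur K lam) = 0 := by
  by_contra h
  obtain ⟨T, hT⟩ := exists_tableau_of_coeff_schur_ne_zero h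
  obtain rfl := eq_highestWeight_of_weight_eq T hT hle
  exact hne (rowContent_injective hT)

end Schur

/-! ### Schur expansions -/

section SchurExpansion

variable {K : Type*} [CommRing K]

theorem exists_eq_mapDomain_antitone (α : ℕ →₀ ℕ) :
    ∃ (n : ℕ) (γ : Fin n →₀ ℕ) (v : Fin n → ℕ),
      Antitone γ ∧ Function.Injective v ∧ α = γ.mapDomain v := by
  let e := α.support.equivFin.symm
  let τ := Tuple.sort fun i => OrderDual.toDual (α (e i))
  let v : Fin α.support.card → ℕ := fun i => e (τ i)
  have hv : Function.Injective v := Subtype.val_injective.comp (e.injective.comp τ.injective)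
  refine ⟨_, α.comapDomain v hv.injOn, v, fun i j hij => ?_, hv, ?_⟩
  · exact Tuple.monotone_sort (fun i => OrderDual.toDual (α (e i))) hij
  · refine (Finsupp.mapDomain_comapDomain v hv α fun k hk => ?_).symm
    exact ⟨τ.symm (e.symm ⟨k, hk⟩), by simp [v]⟩

theorem exists_rowContent_eq_mapDomain {n : ℕ} {γ : Fin n →₀ ℕ} (hγ : Antitone γ) :
    ∃ mu : YoungDiagram, rowContent mu = γ.mapDomain Fin.val := by
  have apply_of_lt {k : ℕ} (hk : k < n) : γ.mapDomain Fin.val k = γ ⟨k, hk⟩ :=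
    Finsupp.mapDomain_apply Fin.val_injective γ ⟨k, hk⟩
  have apply_of_le {k : ℕ} (hk : n ≤ k) : γ.mapDomain Fin.val k = 0 :=
    Finsupp.mapDomain_of_notMem_range _ _ fun ⟨i, hi⟩ => by lia
  have antitone_mapDomain : Antitone (γ.mapDomain Fin.val) := by
    intro i j hij
    rcases lt_or_ge j n with hj | hj
    · rw [apply_of_lt hj, apply_of_lt (hij.trans_lt hj)]
      exact hγ hij
    · rw [apply_of_le hj]
      exact Nat.zero_le _
  obtain ⟨mu, hmu⟩ := exists_youngDiagram_colLen_eq antitone_mapDomain (apply_of_le le_rfl)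
  refine ⟨mu.transpose, ?_⟩
  ext k
  rw [rowContent_apply, YoungDiagram.rowLen_transpose, hmu]

theorem exists_coeff_eq_coeff_rowContent (α : ℕ →₀ ℕ) :
    ∃ mu : YoungDiagram, ∀ f ∈ SymSeries K,
      MvPowerSeries.coeff α f = MvPowerSeries.coeff (rowContent mu) f := by
  obtain ⟨n, γ, v, hγ, hv, rfl⟩ := exists_eq_mapDomain_antitone α
  obtain ⟨mu, hmu⟩ := exists_rowContent_eq_mapDomain hγ
  exact ⟨mu, fun f hf => hmu ▸ coeff_mapDomain_eq hf γ hv Fin.val_injective⟩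

theorem eq_of_coeff_rowContent_eq {f g : MvPowerSeries ℕ K} (hf : f ∈ SymSeries K)
    (hg : g ∈ SymSeries K) (h : ∀ mu, MvPowerSeries.coeff (rowContent mu) f =
      MvPowerSeries.coeff (rowContent mu) g) : f = g := by
  ext α
  obtain ⟨mu, hmu⟩ := exists_coeff_eq_coeff_rowContent (K := K) α
  rw [hmu f hf, hmu g hg, h]

theorem finite_setOf_card_le (n : ℕ) : {lam : YoungDiagram | lam.card ≤ n}.Finite := by
  refine Set.Finite.of_finite_image (f := YoungDiagram.cells) ?_
    (fun a _ b _ h => YoungDiagram.ext h)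
  refine (Finset.finite_toSet (Finset.range n ×ˢ Finset.range n).powerset).subset ?_
  rintro _ ⟨lam, hlam : lam.card ≤ n, rfl⟩
  rw [Finset.mem_coe, Finset.mem_powerset]
  rintro ⟨i, j⟩ hc
  rw [Finset.mem_product, Finset.mem_range, Finset.mem_range]
  constructor
  · calc i < lam.colLen j := YoungDiagram.mem_iff_lt_colLen.1 hc
      _ ≤ lam.card := lam.colLen_eq_card ▸ Finset.card_le_card (Finset.filter_subset _ _)
      _ ≤ n := hlam
  · calc j < lam.rowLen i := YoungDiagram.mem_iff_lt_rowLen.1 hc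
      _ ≤ lam.card := lam.rowLen_eq_card ▸ Finset.card_le_card (Finset.filter_subset _ _)
      _ ≤ n := hlam

/-- The Young diagrams with at most `n` boxes, the range of summation for the Schur expansion of a
series of degree at most `n`. -/
def diagramsLE (n : ℕ) : Finset YoungDiagram := (finite_setOf_card_le n).toFinset

theorem mem_diagramsLE {n : ℕ} {lam : YoungDiagram} : lam ∈ diagramsLE n ↔ lam.card ≤ n := by
  rw [diagramsLE, Set.Finite.mem_toFinset, Set.mem_ofPred_eq]

/-- The series `∑_λ A_λ s_λ`. -/
def schurSeries (A : YoungDiagram → K) : MvPowerSeries ℕ K :=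
  fun α => ∑ᶠ lam, A lam * MvPowerSeries.coeff α (schur K lam)

theorem isSchurExpansion_iff {F : MvPowerSeries ℕ K} {A : YoungDiagram → K} :
    IsSchurExpansion F A ↔ F = schurSeries A :=
  MvPowerSeries.ext_iff.symm

theorem coeff_schurSeries_eq_finsum (A : YoungDiagram → K) (α : ℕ →₀ ℕ) :
    MvPowerSeries.coeff α (schurSeries A) =
      ∑ᶠ lam, A lam * MvPowerSeries.coeff α (schur K lam) := rfl

theorem coeff_schurSeries (A : YoungDiagram → K) (α : ℕ →₀ ℕ) :
    MvPowerSeries.coeff α (schurSeries A) =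
      ∑ lam ∈ diagramsLE α.degree, A lam * MvPowerSeries.coeff α (schur K lam) := by
  refine finsum_eq_sum_of_support_subset _ fun lam h => ?_
  rw [Finset.mem_coe, mem_diagramsLE]
  exact (degree_eq_of_coeff_schur_ne_zero (right_ne_zero_of_mul h)).ge

theorem schurSeries_mem_symSeries (A : YoungDiagram → K) : schurSeries A ∈ SymSeries K := by
  rw [mem_symSeries_iff]
  intro σ α
  rw [coeff_schurSeries_eq_finsum, coeff_schurSeries_eq_finsum]
  exact finsum_congr fun lam => by rw [mem_symSeries_iff.1 (schur_mem_symFun lam).1]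

theorem coeff_rowContent_schurSeries (A : YoungDiagram → K) (mu : YoungDiagram) :
    MvPowerSeries.coeff (rowContent mu) (schurSeries A) =
      A mu + ∑ lam ∈ (diagramsLE mu.card).filter fun lam => rowIndexSum lam < rowIndexSum mu,
        A lam * MvPowerSeries.coeff (rowContent mu) (schur K lam) := by
  rw [coeff_schurSeries, degree_rowContent,
    ← Finset.add_sum_erase _ _ (mem_diagramsLE.2 (le_refl mu.card)), coeff_rowContent_schur_self,
    mul_one]
  congr 1
  symm
  refine Finset.sum_subset (fun lam hlam => ?_) (fun lam hlam hnotMem => ?_)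
  · rw [Finset.mem_filter] at hlam
    exact Finset.mem_erase.2 ⟨fun heq => (heq ▸ hlam.2).ne rfl, hlam.1⟩
  · rw [Finset.mem_erase] at hlam
    rw [Finset.mem_filter, not_and, not_lt] at hnotMem
    rw [coeff_rowContent_schur_eq_zero hlam.1 (hnotMem hlam.2), mul_zero]

/-- The solution of the unitriangular system `coeff_rowContent_schurSeries` for the coefficients of
a Schur expansion of `F`. -/
def triangularSolution (F : MvPowerSeries ℕ K) (mu : YoungDiagram) : K :=
  MvPowerSeries.coeff (rowContent mu) F -
    ∑ lam ∈ ((diagramsLE mu.card).filter fun lam => rowIndexSum lam < rowIndexSum mu).attach,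
      triangularSolution F lam.1 * MvPowerSeries.coeff (rowContent mu) (schur K lam.1)
termination_by rowIndexSum mu
decreasing_by exact (Finset.mem_filter.1 lam.2).2

theorem schurSeries_triangularSolution {F : MvPowerSeries ℕ K} (hF : F ∈ SymSeries K) :
    schurSeries (triangularSolution F) = F := by
  refine eq_of_coeff_rowContent_eq (schurSeries_mem_symSeries _) hF fun mu => ?_
  rw [coeff_rowContent_schurSeries, triangularSolution, Finset.sum_attach
    ((diagramsLE mu.card).filter fun lam => rowIndexSum lam < rowIndexSum mu)
    (fun lam => triangularSolution F lam * MvPowerSeries.coeff (rowContent mu) (schur K lam)),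
    sub_add_cancel]

theorem schurSeries_injective : Function.Injective (schurSeries (K := K)) := by
  intro A B h
  funext mu
  induction mu using (measure rowIndexSum).wf.induction with
  | _ mu ih =>
    have hcoeff := congrArg (MvPowerSeries.coeff (rowContent mu)) h
    rw [coeff_rowContent_schurSeries, coeff_rowContent_schurSeries, Finset.sum_congr rfl
      fun lam hlam => by rw [ih lam (Finset.mem_filter.1 hlam).2]] at hcoeff
    exact add_right_cancel hcoeff

theorem schurCoeff_schurSeries (A : YoungDiagram → K) : schurCoeff (schurSeries A) = A := by
  have h : ∃! B : YoungDiagram → K, IsSchurExpansion (schurSeries A) B :=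
    ⟨A, isSchurExpansion_iff.2 rfl,
      fun B hB => schurSeries_injective (isSchurExpansion_iff.1 hB).symm⟩
  rw [schurCoeff, dif_pos h]
  exact schurSeries_injective (isSchurExpansion_iff.1 h.choose_spec.1).symm

theorem schurSeries_schurCoeff {F : MvPowerSeries ℕ K} (hF : F ∈ SymSeries K) :
    schurSeries (schurCoeff F) = F := by
  obtain ⟨A, rfl⟩ : ∃ A, F = schurSeries A := ⟨_, (schurSeries_triangularSolution hF).symm⟩
  rw [schurCoeff_schurSeries]

theorem schurSeries_add (A B : YoungDiagram → K) :
    schurSeries (A + B) = schurSeries A + schurSeries B := by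
  ext α
  rw [map_add, coeff_schurSeries, coeff_schurSeries, coeff_schurSeries, ← Finset.sum_add_distrib]
  exact Finset.sum_congr rfl fun lam _ => add_mul _ _ _

theorem schurSeries_smul (c : K) (A : YoungDiagram → K) :
    schurSeries (c • A) = c • schurSeries A := by
  ext α
  rw [MvPowerSeries.coeff_smul, coeff_schurSeries, coeff_schurSeries, Finset.mul_sum]
  exact Finset.sum_congr rfl fun lam _ => mul_assoc _ _ _

theorem schurCoeff_add {F G : MvPowerSeries ℕ K} (hF : F ∈ SymSeries K) (hG : G ∈ SymSeries K) :
    schurCoeff (F + G) = schurCoeff F + schurCoeff G := by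
  rw [← schurCoeff_schurSeries (schurCoeff F + schurCoeff G), schurSeries_add,
    schurSeries_schurCoeff hF, schurSeries_schurCoeff hG]

theorem schurCoeff_smul (c : K) {F : MvPowerSeries ℕ K} (hF : F ∈ SymSeries K) :
    schurCoeff (c • F) = c • schurCoeff F := by
  rw [← schurCoeff_schurSeries (c • schurCoeff F), schurSeries_smul, schurSeries_schurCoeff hF]

theorem schurCoeff_schur (lam : YoungDiagram) :
    schurCoeff (schur K lam) = Pi.single lam 1 := by
  rw [← schurCoeff_schurSeries (Pi.single lam (1 : K))]
  congr 1
  ext α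
  rw [coeff_schurSeries_eq_finsum, finsum_eq_single _ lam fun mu h => by
    rw [Pi.single_eq_of_ne h, zero_mul], Pi.single_eq_same, one_mul]

theorem schurCoeff_eq_zero_of_lt_card {N : ℕ} {F : MvPowerSeries ℕ K} (hF : F ∈ SymSeries K)
    (hN : IsDegreeBound N F) {lam : YoungDiagram} (hlam : N < lam.card) :
    schurCoeff F lam = 0 := by
  have truncation : F = schurSeries fun mu => if mu.card ≤ N then schurCoeff F mu else 0 := by
    ext α
    by_cases hα : α.degree ≤ N
    · conv_lhs => rw [← schurSeries_schurCoeff hF]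
      rw [coeff_schurSeries, coeff_schurSeries]
      exact Finset.sum_congr rfl fun mu hmu => by rw [if_pos ((mem_diagramsLE.1 hmu).trans hα)]
    · rw [of_not_not fun h => hα (hN α h), coeff_schurSeries_eq_finsum]
      refine (finsum_eq_zero_of_forall_eq_zero fun mu => ?_).symm
      rw [ite_mul, zero_mul, ite_eq_right_iff]
      intro hmu
      rw [coeff_schur_eq_zero_of_degree_ne (by omega), mul_zero]
  rw [truncation, schurCoeff_schurSeries, if_neg hlam.not_ge]

theorem eq_sum_schurSym {N : ℕ} {f : SymFun K} (hN : IsDegreeBound N (f : MvPowerSeries ℕ K)) :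
    f = ∑ lam ∈ diagramsLE N, schurCoeff (f : MvPowerSeries ℕ K) lam • schurSym K lam := by
  ext α
  rw [AddSubmonoidClass.coe_finsetSum, map_sum]
  conv_lhs => rw [← schurSeries_schurCoeff f.2.1]
  refine finsum_eq_sum_of_support_subset _ fun lam hlam => ?_
  rw [Finset.mem_coe, mem_diagramsLE]
  by_contra! h
  exact left_ne_zero_of_mul hlam (schurCoeff_eq_zero_of_lt_card f.2.1 hN h)

theorem linearMap_ext_schurSym {M : Type*} [AddCommMonoid M] [Module K M]
    {φ ψ : SymFun K →ₗ[K] M} (h : ∀ lam, φ (schurSym K lam) = ψ (schurSym K lam)) : φ = ψ := by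
  ext f
  obtain ⟨N, hN⟩ := f.2.2
  rw [eq_sum_schurSym hN, map_sum, map_sum]
  exact Finset.sum_congr rfl fun lam _ => by rw [map_smul, map_smul, h]

theorem finite_support_hall (F : SymSeries K) (f : SymFun K) :
    (Function.support fun lam : YoungDiagram =>
      schurCoeff (F : MvPowerSeries ℕ K) lam * schurCoeff (f : MvPowerSeries ℕ K) lam).Finite := by
  obtain ⟨N, hN⟩ := f.2.2
  refine (finite_setOf_card_le N).subset fun lam hlam => ?_
  by_contra h
  exact right_ne_zero_of_mul hlam (schurCoeff_eq_zero_of_lt_card f.2.1 hN (not_le.1 h))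

/-- The Hall inner product with a fixed series, as a linear map. -/
def hallLinear (F : SymSeries K) : SymFun K →ₗ[K] K where
  toFun := hall F
  map_add' f g := by
    rw [hall, hall, hall, ← finsum_add_distrib (finite_support_hall F f) (finite_support_hall F g)]
    refine finsum_congr fun lam => ?_
    rw [← mul_add]
    exact congrArg _ (congrFun (schurCoeff_add f.2.1 g.2.1) lam)
  map_smul' c f := by
    rw [hall, hall, RingHom.id_apply, smul_finsum' c (finite_support_hall F f)]
    refine finsum_congr fun lam => ?_
    rw [smul_eq_mul, mul_left_comm]
    exact congrArg _ (congrFun (schurCoeff_smul c f.2.1) lam)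

theorem hallLinear_apply (F : SymSeries K) (f : SymFun K) : hallLinear F f = hall F f := rfl

theorem hall_schurSym (F : SymSeries K) (lam : YoungDiagram) :
    hall F (schurSym K lam) = schurCoeff (F : MvPowerSeries ℕ K) lam := by
  change ∑ᶠ mu, schurCoeff (F : MvPowerSeries ℕ K) mu * schurCoeff (schur K lam) mu = _
  rw [schurCoeff_schur, finsum_eq_single _ lam fun mu h => by rw [Pi.single_eq_of_ne h, mul_zero],
    Pi.single_eq_same, mul_one]

end SchurExpansion

/-! ### The pairing with `E(t)` -/

theorem colLen_column (k j : ℕ) : (column k).colLen j = if j = 0 then k else 0 := by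
  have lt_colLen_iff : ∀ i, i < (column k).colLen j ↔ i < k ∧ j = 0 := by
    intro i
    rw [← YoungDiagram.mem_iff_lt_colLen, ← YoungDiagram.mem_cells]
    simp [column, eq_comm]
  refine eq_of_forall_lt_iff fun i => ?_
  rw [lt_colLen_iff]
  split_ifs with hj <;> simp [hj]

theorem card_column (k : ℕ) : (column k).card = k := by
  simp [YoungDiagram.card, column]

theorem column_injective : Function.Injective column :=
  Function.LeftInverse.injective card_column

theorem column_zero : column 0 = ⊥ := by
  ext c
  simp [column]

theorem card_bot : (⊥ : YoungDiagram).card = 0 := rfl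

theorem colLen_bot (j : ℕ) : (⊥ : YoungDiagram).colLen j = 0 := by
  rw [← column_zero, colLen_column, ite_self]

theorem column_le_iff {k : ℕ} {lam : YoungDiagram} : column k ≤ lam ↔ k ≤ lam.colLen 0 := by
  rw [le_iff_colLen_le]
  constructor
  · intro h
    simpa only [colLen_column, if_true] using h 0
  · intro h j
    rw [colLen_column]
    split_ifs with hj
    · rwa [hj]
    · exact Nat.zero_le _

theorem eq_column_of_colLen_one_eq_zero {nu : YoungDiagram} (h : nu.colLen 1 = 0) :
    nu = column (nu.colLen 0) := by
  refine eq_of_colLen_eq fun j => ?_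
  rw [colLen_column]
  split_ifs with hj
  · rw [hj]
  · exact colLen_eq_zero_of_le h (Nat.one_le_iff_ne_zero.2 hj)

theorem isVerticalStrip_column (k : ℕ) : IsVerticalStrip (column k) ⊥ :=
  isVerticalStrip_iff.2 fun j => by simp [colLen_column]

theorem eq_column_of_isVerticalStrip {nu : YoungDiagram} (h : IsVerticalStrip nu ⊥) :
    nu = column (nu.colLen 0) :=
  eq_column_of_colLen_one_eq_zero <|
    Nat.eq_zero_of_le_zero <| (isVerticalStrip_iff.1 h 0).trans (colLen_bot 0).le

theorem sum_isVerticalStrip_bot {M : Type*} [AddCommMonoid M] (lam : YoungDiagram)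
    (F : YoungDiagram → M) :
    ∑ nu ∈ Finset.Icc ⊥ lam with IsVerticalStrip nu ⊥, F nu =
      ∑ k ∈ Finset.range (lam.colLen 0 + 1), F (column k) := by
  have image_column : ((Finset.range (lam.colLen 0 + 1)).image column) =
      (Finset.Icc ⊥ lam).filter (IsVerticalStrip · ⊥) := by
    ext nu
    simp only [Finset.mem_image, Finset.mem_range, Nat.lt_succ_iff, Finset.mem_filter,
      Finset.mem_Icc, bot_le, true_and, ← column_le_iff]
    constructor
    · rintro ⟨k, hk, rfl⟩
      exact ⟨hk, isVerticalStrip_column k⟩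
    · rintro ⟨hle, hstrip⟩
      have heq := eq_column_of_isVerticalStrip hstrip
      exact ⟨nu.colLen 0, heq ▸ hle, heq.symm⟩
  rw [← image_column, Finset.sum_image column_injective.injOn]

/-- `λ/μ` is a horizontal strip: it has at most one box in each column. -/
def IsHorizontalStrip (lam mu : YoungDiagram) : Prop :=
  ∀ c ∈ skewCells lam mu, ∀ d ∈ skewCells lam mu, c.2 = d.2 → c = d

instance (lam mu : YoungDiagram) : Decidable (IsHorizontalStrip lam mu) := by
  unfold IsHorizontalStrip
  infer_instance

theorem isHorizontalStrip_iff_numColumns_eq {lam mu : YoungDiagram} :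
    IsHorizontalStrip lam mu ↔ numColumns lam mu = skewSize lam mu :=
  Finset.card_image_iff.symm

theorem isHorizontalStrip_iff {lam mu : YoungDiagram} :
    IsHorizontalStrip lam mu ↔ ∀ j, lam.colLen j ≤ mu.colLen j + 1 := by
  constructor
  · intro h j
    by_contra! hlt
    have heq := h (mu.colLen j, j) (mem_skewCells.2 ⟨le_rfl, by omega⟩)
      (mu.colLen j + 1, j) (mem_skewCells.2 ⟨by omega, hlt⟩) rfl
    simp at heq
  · rintro h ⟨i, j⟩ hc ⟨i', j'⟩ hd (rfl : j = j')
    have := h j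
    rw [mem_skewCells] at hc hd
    rw [Prod.mk.injEq]
    omega

theorem isHorizontalStrip_column_iff {lam : YoungDiagram} {k : ℕ} :
    IsHorizontalStrip lam (column k) ↔ lam.colLen 0 ≤ k + 1 ∧ lam.colLen 1 ≤ 1 := by
  simp only [isHorizontalStrip_iff, colLen_column]
  constructor
  · intro h
    exact ⟨h 0, h 1⟩
  · rintro ⟨hzero, hone⟩ j
    split_ifs with hj
    · rwa [hj]
    · exact (lam.colLen_anti 1 j (Nat.one_le_iff_ne_zero.2 hj)).trans hone

section Pairing

variable {K : Type*} [CommRing K]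

theorem elemSym_mem_symSeries (i : ℕ) : elemSym K i ∈ SymSeries K :=
  mem_symSeries_iff.2 (coeff_elemSym_perm i)

theorem coeff_elemSym (i : ℕ) (α : ℕ →₀ ℕ) : MvPowerSeries.coeff α (elemSym K i) =
    if α.degree = i ∧ ∀ j ∈ α.support, α j = 1 then 1 else 0 := rfl

theorem rowLen_le_one_iff {mu : YoungDiagram} : (∀ k, mu.rowLen k ≤ 1) ↔ mu = column mu.card := by
  constructor
  · intro h
    have hone : mu.colLen 1 = 0 := by
      by_contra hne
      have := YoungDiagram.mem_iff_lt_rowLen.1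
        (YoungDiagram.mem_iff_lt_colLen.2 (Nat.pos_of_ne_zero hne))
      exact (h 0).not_gt this
    have heq := eq_column_of_colLen_one_eq_zero hone
    rw [heq, card_column]
  · intro h k
    rw [h]
    by_contra! hlt
    have := YoungDiagram.mem_iff_lt_colLen.1 (YoungDiagram.mem_iff_lt_rowLen.2 hlt)
    simp [colLen_column] at this

theorem coeff_rowContent_elemSym (i : ℕ) (mu : YoungDiagram) :
    MvPowerSeries.coeff (rowContent mu) (elemSym K i) = if mu = column i then 1 else 0 := by
  have squarefree_iff : (∀ k ∈ (rowContent mu).support, rowContent mu k = 1) ↔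
      mu = column mu.card := by
    rw [← rowLen_le_one_iff]
    simp only [Finsupp.mem_support_iff, rowContent_apply]
    exact forall_congr' fun k => by omega
  rw [coeff_elemSym, degree_rowContent]
  refine if_congr ?_ rfl rfl
  rw [squarefree_iff]
  exact ⟨fun h => h.1 ▸ h.2, fun h => by rw [h, card_column]; exact ⟨rfl, rfl⟩⟩

theorem tableauWeight_column_le_one {i : ℕ} (T : SemistandardYoungTableau (column i)) (k : ℕ) :
    tableauWeight T k ≤ 1 := by
  rw [tableauWeight_apply, Finset.card_le_one]
  simp only [Finset.mem_filter]
  rintro c ⟨hc, rfl⟩ d ⟨hd, heq⟩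
  refine injOn_entry_column T hc hd (Prod.ext heq.symm ?_)
  simp only [column, Finset.mem_product, Finset.mem_singleton] at hc hd
  exact hc.2.trans hd.2.symm

theorem schur_column (i : ℕ) : schur K (column i) = elemSym K i := by
  refine eq_of_coeff_rowContent_eq (schur_mem_symFun _).1 (elemSym_mem_symSeries i) fun mu => ?_
  rw [coeff_rowContent_elemSym]
  split_ifs with h
  · rw [h, coeff_rowContent_schur_self]
  · by_contra hne
    obtain ⟨T, hT⟩ := exists_tableau_of_coeff_schur_ne_zero hne
    have hcard : mu.card = i := by
      rw [← degree_rowContent, ← hT, degree_tableauWeight, card_column]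
    refine h (hcard ▸ rowLen_le_one_iff.1 fun k => ?_)
    rw [← rowContent_apply, ← hT]
    exact tableauWeight_column_le_one T k

theorem coeff_ESeries (t : K) (α : ℕ →₀ ℕ) : MvPowerSeries.coeff α (ESeries t) =
    t ^ α.degree * MvPowerSeries.coeff α (elemSym K α.degree) := by
  refine Finset.sum_eq_single_of_mem _ (Finset.self_mem_range_succ _) fun i _ hi => ?_
  rw [coeff_elemSym, if_neg fun h => hi h.1.symm, mul_zero]

theorem ESeries_eq_schurSeries (t : K) : ESeries t =
    schurSeries fun lam => if IsVerticalStrip lam ⊥ then t ^ lam.card else 0 := by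
  ext α
  rw [coeff_ESeries, coeff_schurSeries, Finset.sum_eq_single_of_mem (column α.degree),
    if_pos (isVerticalStrip_column _), card_column, schur_column]
  · rw [mem_diagramsLE, card_column]
  · intro lam _ hne
    rw [ite_mul, zero_mul, ite_eq_right_iff]
    intro hstrip
    obtain ⟨k, rfl⟩ : ∃ k, lam = column k := ⟨_, eq_column_of_isVerticalStrip hstrip⟩
    rw [coeff_schur_eq_zero_of_degree_ne, mul_zero]
    rintro hdeg
    rw [hdeg, card_column] at hne
    exact hne rfl

theorem hall_E_schurSym (t : K) (lam : YoungDiagram) :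
    hall (E t) (schurSym K lam) = if IsVerticalStrip lam ⊥ then t ^ lam.card else 0 := by
  rw [hall_schurSym]
  change schurCoeff (ESeries t) lam = _
  rw [ESeries_eq_schurSeries, schurCoeff_schurSeries]

theorem coeff_consExp_schur (b : ℕ) (β : ℕ →₀ ℕ) (lam : YoungDiagram) :
    MvPowerSeries.coeff (consExp b β) (schur K lam) =
      ∑ nu ∈ Finset.Icc ⊥ lam with IsHorizontalStrip lam nu,
        if b = skewSize lam nu then MvPowerSeries.coeff β (schur K nu) else 0 := by
  have degree_le : ∀ nu, dualGCoeff K β ⊥ nu ≠ 0 → β.degree ≤ nu.card := by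
    intro nu hne
    rw [dualGCoeff_apply _ bot_le] at hne
    exact skewSize_bot nu ▸ degree_le_of_coeff_dualG_ne_zero hne
  -- The branching rule is the top-degree part of `dualGCoeff_consExp`.
  rw [coeff_schur_eq_ite, degree_consExp, dualGCoeff_consExp,
    (columnIndicator_dualGCoeff_comm b β).eq, IncidenceAlgebra.mul_apply, Finset.sum_filter,
    Finset.ite_sum_zero]
  refine Finset.sum_congr rfl fun nu hnu => ?_
  have hle := (Finset.mem_Icc.1 hnu).2
  have hcard := skewSize_add_card hle
  have hcolumns := numColumns_le_skewSize lam nu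
  simp only [columnIndicator_apply b hle, coeff_schur_eq_ite, isHorizontalStrip_iff_numColumns_eq]
  by_cases hzero : dualGCoeff K β ⊥ nu = 0
  · simp only [hzero, zero_mul, ite_self]
  · have := degree_le nu hzero
    rw [mul_ite, mul_one, mul_zero]
    split_ifs <;> first | rfl | omega

theorem specialize_schurSym (s : K) (lam : YoungDiagram) :
    specialize s (schurSym K lam) =
      ∑ nu ∈ Finset.Icc ⊥ lam with IsHorizontalStrip lam nu,
        s ^ skewSize lam nu • schurSym K nu := by
  ext β
  rw [coeff_specialize s (f := schurSym K lam) (isDegreeBound_schur lam),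
    AddSubmonoidClass.coe_finsetSum, map_sum]
  change ∑ b ∈ _, s ^ b * MvPowerSeries.coeff (consExp b β) (schur K lam) =
    ∑ nu ∈ _, s ^ skewSize lam nu * MvPowerSeries.coeff β (schur K nu)
  simp only [coeff_consExp_schur, Finset.mul_sum]
  rw [Finset.sum_comm]
  refine Finset.sum_congr rfl fun nu hnu => ?_
  have hcard := skewSize_add_card (Finset.mem_Icc.1 (Finset.mem_filter.1 hnu).1).2
  simp only [mul_ite, mul_zero]
  rw [Finset.sum_ite_eq', if_pos (Finset.mem_range.2 (by omega))]

theorem coeff_zero_schur (lam : YoungDiagram) :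
    MvPowerSeries.coeff 0 (schur K lam) = if lam = ⊥ then 1 else 0 := by
  rw [coeff_schur_eq_ite, dualGCoeff_zero, IncidenceAlgebra.one_apply, map_zero]
  by_cases h : lam = ⊥
  · rw [h, if_pos rfl, if_pos card_bot.symm]
  · rw [if_neg (Ne.symm h), if_neg h, ite_self]

theorem hall_E_specialize_schurSym_eq_sum (s t : K) (lam : YoungDiagram) :
    hall (E t) (specialize s (schurSym K lam)) = ∑ k ∈ Finset.range (lam.colLen 0 + 1),
      if IsHorizontalStrip lam (column k) then s ^ skewSize lam (column k) * t ^ k else 0 := by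
  have hall_smul : ∀ nu, hallLinear (E t) (s ^ skewSize lam nu • schurSym K nu) =
      if IsVerticalStrip nu ⊥ then s ^ skewSize lam nu * t ^ nu.card else 0 := by
    intro nu
    rw [map_smul, hallLinear_apply, hall_E_schurSym, smul_eq_mul, mul_ite, mul_zero]
  rw [specialize_schurSym, ← hallLinear_apply, map_sum]
  simp only [hall_smul]
  rw [← Finset.sum_filter, Finset.filter_filter]
  simp only [and_comm (a := IsHorizontalStrip _ _)]
  rw [← Finset.filter_filter, Finset.sum_filter, sum_isVerticalStrip_bot]
  simp only [card_column]

theorem hall_E_specialize_neg_schurSym (t : K) (lam : YoungDiagram) :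
    hall (E t) (specialize (-t) (schurSym K lam)) = if lam = ⊥ then 1 else 0 := by
  rw [hall_E_specialize_schurSym_eq_sum]
  simp only [isHorizontalStrip_column_iff]
  rcases hlen : lam.colLen 0 with _ | m
  · have hbot : lam = ⊥ := by
      rw [eq_column_of_colLen_one_eq_zero (colLen_eq_zero_of_le hlen zero_le_one), hlen,
        column_zero]
    subst hbot
    simp [colLen_bot, column_zero, skewSize_bot, card_bot]
  · have hbot : lam ≠ ⊥ := by
      rintro rfl
      rw [colLen_bot] at hlen
      omega
    -- Only the columns of lengths `m` and `m + 1` contribute, and they cancel.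
    rw [if_neg hbot, Finset.sum_range_succ, Finset.sum_range_succ, Finset.sum_eq_zero, zero_add]
    · have hcard := skewSize_add_card (column_le_iff.2 (show m ≤ lam.colLen 0 by omega))
      have hcard' := skewSize_add_card (column_le_iff.2 (show m + 1 ≤ lam.colLen 0 by omega))
      rw [card_column] at hcard hcard'
      rw [show skewSize lam (column m) = skewSize lam (column (m + 1)) + 1 by omega]
      simp only [le_refl, Nat.le_succ, true_and]
      split_ifs
      · ring
      · exact add_zero _
    · intro k hk
      rw [Finset.mem_range] at hk
      exact if_neg fun h => by omega

theorem hall_E_specialize_neg (t : K) (f : SymFun K) :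
    hall (E t) (specialize (-t) f) = MvPowerSeries.coeff 0 (f : MvPowerSeries ℕ K) := by
  have h : (hallLinear (E t)).comp (specialize (-t)).toLinearMap =
      (MvPowerSeries.coeff 0).comp (SymFun K).val.toLinearMap :=
    linearMap_ext_schurSym fun lam =>
      (hall_E_specialize_neg_schurSym t lam).trans (coeff_zero_schur lam).symm
  exact LinearMap.congr_fun h f

/-! ### `E(t)^⊥` is inverse to a specialization -/

theorem perp_E_specialize_neg (t : K) (f : SymFun K) :
    perp (E t) (specialize (-t) f) = f := by
  ext β
  rw [coeff_perp, symCoeff_specialize, hall_E_specialize_neg, coeff_zero_symCoeff]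

theorem specialize_perp (s : K) (F : SymSeries K) (f : SymFun K) :
    specialize s (perp F f) = perp F (specialize s f) := by
  obtain ⟨M, hM⟩ := f.2.2
  obtain ⟨N, hN⟩ := (perp F f).2.2
  have hM' : IsDegreeBound (max M N) (f : MvPowerSeries ℕ K) :=
    IsDegreeBound.mono hM (le_max_left M N)
  have hN' : IsDegreeBound (max M N) (perp F f : MvPowerSeries ℕ K) :=
    IsDegreeBound.mono hN (le_max_right M N)
  ext β
  rw [coeff_specialize s hN', coeff_perp, symCoeff_specialize_eq_sum s hM', ← hallLinear_apply,
    map_sum]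
  exact Finset.sum_congr rfl fun b _ => by rw [map_smul, coeff_perp, smul_eq_mul, hallLinear_apply]

theorem specialize_neg_perp_E (t : K) (f : SymFun K) :
    specialize (-t) (perp (E t) f) = f := by
  rw [specialize_perp, perp_E_specialize_neg]

/-- `E(t)^⊥` as an automorphism of the algebra of symmetric functions. -/
def perpEquiv (t : K) : SymFun K ≃ₐ[K] SymFun K :=
  (AlgEquiv.ofBijective (specialize (-t))
    ⟨Function.LeftInverse.injective (perp_E_specialize_neg t),
      Function.RightInverse.surjective (specialize_neg_perp_E t)⟩).symm

theorem perpEquiv_apply (t : K) (f : SymFun K) : perpEquiv t f = perp (E t) f := by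
  rw [perpEquiv, AlgEquiv.symm_apply_eq]
  exact (specialize_neg_perp_E t f).symm

end Pairing

/-! ### The action of `E(t)^⊥` on dual stable Grothendieck polynomials -/

section Action

variable {K : Type*} [CommRing K]

theorem skewSize_anti_left {lam mu nu : YoungDiagram} (h : mu ≤ nu) :
    skewSize lam nu ≤ skewSize lam mu :=
  Finset.card_le_card (Finset.sdiff_subset_sdiff subset_rfl (YoungDiagram.cells_subset_iff.2 h))

theorem skewSize_mono_right {lam mu nu : YoungDiagram} (h : nu ≤ lam) :
    skewSize nu mu ≤ skewSize lam mu :=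
  Finset.card_le_card (Finset.sdiff_subset_sdiff (YoungDiagram.cells_subset_iff.2 h) subset_rfl)

theorem columnWeight_apply_eq_sum (s : K) {lam mu : YoungDiagram} (h : mu ≤ lam) {N : ℕ}
    (hN : skewSize lam mu ≤ N) :
    columnWeight s mu lam = ∑ b ∈ Finset.range (N + 1), s ^ b * columnIndicator K b mu lam := by
  have hmem : numColumns lam mu ∈ Finset.range (N + 1) :=
    Finset.mem_range.2 (Nat.lt_succ_of_le ((numColumns_le_skewSize lam mu).trans hN))
  simp only [columnWeight, incidenceElement_apply _ h, columnIndicator_apply _ h, mul_ite, mul_one,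
    mul_zero]
  rw [Finset.sum_ite_eq, if_pos hmem]

theorem mul_columnWeight_apply (F : IncidenceAlgebra K YoungDiagram) (s : K)
    (mu lam : YoungDiagram) :
    (F * columnWeight s) mu lam = ∑ b ∈ Finset.range (skewSize lam mu + 1),
      s ^ b * (F * columnIndicator K b) mu lam := by
  simp only [IncidenceAlgebra.mul_apply, Finset.mul_sum]
  rw [Finset.sum_comm]
  refine Finset.sum_congr rfl fun nu hnu => ?_
  rw [Finset.mem_Icc] at hnu
  rw [columnWeight_apply_eq_sum s hnu.2 (skewSize_anti_left hnu.1), Finset.mul_sum]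
  exact Finset.sum_congr rfl fun b _ => mul_left_comm _ _ _

theorem columnWeight_mul_apply (F : IncidenceAlgebra K YoungDiagram) (s : K)
    (mu lam : YoungDiagram) :
    (columnWeight s * F) mu lam = ∑ b ∈ Finset.range (skewSize lam mu + 1),
      s ^ b * (columnIndicator K b * F) mu lam := by
  simp only [IncidenceAlgebra.mul_apply, Finset.mul_sum]
  rw [Finset.sum_comm]
  refine Finset.sum_congr rfl fun nu hnu => ?_
  rw [Finset.mem_Icc] at hnu
  rw [columnWeight_apply_eq_sum s hnu.1 (skewSize_mono_right hnu.2), Finset.sum_mul]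
  exact Finset.sum_congr rfl fun b _ => mul_assoc _ _ _

theorem columnWeight_dualGCoeff_comm (s : K) (α : ℕ →₀ ℕ) :
    Commute (columnWeight s) (dualGCoeff K α) := by
  ext mu lam _
  rw [columnWeight_mul_apply, mul_columnWeight_apply]
  exact Finset.sum_congr rfl fun b _ => by rw [(columnIndicator_dualGCoeff_comm b α).eq]

theorem stripWeight_dualGCoeff_comm (t : K) (α : ℕ →₀ ℕ) :
    Commute (stripWeight t) (dualGCoeff K α) := by
  let u : (IncidenceAlgebra K YoungDiagram)ˣ :=
    ⟨columnWeight (-t), stripWeight t, columnWeight_neg_mul_stripWeight t,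
      stripWeight_mul_columnWeight_neg t⟩
  exact Commute.units_inv_left (u := u) (columnWeight_dualGCoeff_comm (-t) α)

theorem degree_le_of_mul_dualGCoeff_ne_zero {H : IncidenceAlgebra K YoungDiagram} {α : ℕ →₀ ℕ}
    {mu lam : YoungDiagram} (h : (H * dualGCoeff K α) mu lam ≠ 0) :
    α.degree ≤ skewSize lam mu := by
  obtain ⟨nu, hnu, hne⟩ := Finset.exists_ne_zero_of_sum_ne_zero h
  rw [Finset.mem_Icc] at hnu
  rw [dualGCoeff_apply α hnu.2] at hne
  exact (degree_le_of_coeff_dualG_ne_zero (right_ne_zero_of_mul hne)).trans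
    (skewSize_anti_left hnu.1)

/-- The symmetric function `∑_ν H(μ, ν) g_{λ/ν}`, on which operators that are compatible with all
skew shapes at once act through multiplication of `H`. -/
def dualGSum (H : IncidenceAlgebra K YoungDiagram) (mu lam : YoungDiagram) : SymFun K :=
  ⟨fun α => (H * dualGCoeff K α) mu lam,
    mem_symSeries_iff.2 fun σ α =>
      congrArg (fun G : IncidenceAlgebra K YoungDiagram => (H * G) mu lam)
        (dualGCoeff_mapDomain σ α),
    skewSize lam mu, fun _ => degree_le_of_mul_dualGCoeff_ne_zero⟩

theorem coeff_dualGSum (H : IncidenceAlgebra K YoungDiagram) (mu lam : YoungDiagram)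
    (α : ℕ →₀ ℕ) : MvPowerSeries.coeff α (dualGSum H mu lam : MvPowerSeries ℕ K) =
      (H * dualGCoeff K α) mu lam := rfl

theorem dualGSum_one {lam mu : YoungDiagram} (h : mu ≤ lam) :
    dualGSum 1 mu lam = ⟨dualG K lam mu, dualG_mem_symFun h⟩ := by
  ext α
  rw [coeff_dualGSum, one_mul, dualGCoeff_apply α h]

theorem specialize_dualGSum (s : K) (H : IncidenceAlgebra K YoungDiagram)
    (mu lam : YoungDiagram) :
    specialize s (dualGSum H mu lam) = dualGSum (H * columnWeight s) mu lam := by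
  ext β
  rw [coeff_specialize s (f := dualGSum H mu lam) (N := skewSize lam mu)
    (fun _ => degree_le_of_mul_dualGCoeff_ne_zero), coeff_dualGSum, mul_assoc,
    (columnWeight_dualGCoeff_comm s β).eq, ← mul_assoc, mul_columnWeight_apply]
  refine Finset.sum_congr rfl fun b _ => ?_
  rw [coeff_dualGSum, dualGCoeff_consExp, (columnIndicator_dualGCoeff_comm b β).eq, mul_assoc]

theorem perp_E_dualGSum (t : K) (H : IncidenceAlgebra K YoungDiagram) (mu lam : YoungDiagram) :
    perp (E t) (dualGSum H mu lam) = dualGSum (H * stripWeight t) mu lam := by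
  rw [← perp_E_specialize_neg t (dualGSum (H * stripWeight t) mu lam), specialize_dualGSum,
    mul_assoc, stripWeight_mul_columnWeight_neg, mul_one]

theorem coeff_perp_E_dualG (t : K) {lam mu : YoungDiagram} (h : mu ≤ lam) (α : ℕ →₀ ℕ) :
    MvPowerSeries.coeff α
        (perp (E t) ⟨dualG K lam mu, dualG_mem_symFun h⟩ : MvPowerSeries ℕ K) =
      (stripWeight t * dualGCoeff K α) mu lam := by
  rw [← dualGSum_one h, perp_E_dualGSum, one_mul, coeff_dualGSum]

theorem coe_perp_E_dualG_left (t : K) {lam mu : YoungDiagram} (h : mu ≤ lam) :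
    (perp (E t) ⟨dualG K lam mu, dualG_mem_symFun h⟩ : MvPowerSeries ℕ K) =
      ∑ nu ∈ Finset.Icc mu lam with IsVerticalStrip lam nu,
        stripCoeff t lam nu • dualG K nu mu := by
  ext α
  rw [coeff_perp_E_dualG t h, (stripWeight_dualGCoeff_comm t α).eq, stripWeight, dualGCoeff,
    incidenceElement_mul_apply, map_sum, Finset.sum_filter]
  simp only [mul_comm (MvPowerSeries.coeff _ _), ite_mul, zero_mul, MvPowerSeries.coeff_smul]

theorem coe_perp_E_dualG_right (t : K) {lam mu : YoungDiagram} (h : mu ≤ lam) :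
    (perp (E t) ⟨dualG K lam mu, dualG_mem_symFun h⟩ : MvPowerSeries ℕ K) =
      ∑ nu ∈ Finset.Icc mu lam with IsVerticalStrip nu mu,
        stripCoeff t nu mu • dualG K lam nu := by
  ext α
  rw [coeff_perp_E_dualG t h, stripWeight, dualGCoeff, incidenceElement_mul_apply, map_sum,
    Finset.sum_filter]
  simp only [ite_mul, zero_mul, MvPowerSeries.coeff_smul]

theorem stripCoeff_column (t : K) (k : ℕ) : stripCoeff t (column k) ⊥ = stripFactor t k := by
  rw [stripCoeff_eq_prod t ⊥ (n := 1) (by simp [colLen_column]), Finset.prod_range_one,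
    colLen_column, if_pos rfl, colLen_bot, Nat.sub_zero]

theorem coe_perp_E_dualG_bot (t : K) (lam : YoungDiagram) :
    (perp (E t) ⟨dualG K lam ⊥, dualG_mem_symFun bot_le⟩ : MvPowerSeries ℕ K) =
      dualG K lam ⊥ + ∑ k ∈ Finset.Icc 1 (lam.colLen 0),
        (t * (t + 1) ^ (k - 1)) • dualG K lam (column k) := by
  rw [coe_perp_E_dualG_right t bot_le, sum_isVerticalStrip_bot, Finset.range_eq_Ico,
    Finset.sum_eq_sum_Ico_succ_bot (Nat.succ_pos _), Nat.succ_eq_add_one,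
    Finset.Ico_add_one_right_eq_Icc, stripCoeff_column, column_zero, stripFactor, if_pos rfl,
    one_smul]
  refine congrArg _ (Finset.sum_congr rfl fun k hk => ?_)
  rw [stripCoeff_column, stripFactor, if_neg (Nat.one_le_iff_ne_zero.1 (Finset.mem_Icc.1 hk).1)]

end Action

end

end DualGrothendieck

theorem mainTheorem9 {K : Type*} [CommRing K] (t : K) :
    -- `E(t)^⊥` is an automorphism of the `K`-algebra `Λ`
    (∃ φ : DualGrothendieck.SymFun K ≃ₐ[K] DualGrothendieck.SymFun K,
      ∀ f, φ f = DualGrothendieck.perp (DualGrothendieck.E t) f) ∧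
    -- skew shapes
    (∀ lam mu : YoungDiagram, mu ≤ lam →
      ∃ hg : DualGrothendieck.dualG K lam mu ∈ DualGrothendieck.SymFun K,
        (DualGrothendieck.perp (DualGrothendieck.E t) ⟨DualGrothendieck.dualG K lam mu, hg⟩ :
            MvPowerSeries ℕ K) =
          ∑ nu ∈ Finset.Icc mu lam with DualGrothendieck.IsVerticalStrip lam nu,
            DualGrothendieck.stripCoeff t lam nu • DualGrothendieck.dualG K nu mu ∧
        (DualGrothendieck.perp (DualGrothendieck.E t) ⟨DualGrothendieck.dualG K lam mu, hg⟩ :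
            MvPowerSeries ℕ K) =
          ∑ nu ∈ Finset.Icc mu lam with DualGrothendieck.IsVerticalStrip nu mu,
            DualGrothendieck.stripCoeff t nu mu • DualGrothendieck.dualG K lam nu) ∧
    -- straight shapes, `g_λ = g_{λ/∅}`
    (∀ lam : YoungDiagram,
      ∃ hg : DualGrothendieck.dualG K lam ⊥ ∈ DualGrothendieck.SymFun K,
        (DualGrothendieck.perp (DualGrothendieck.E t) ⟨DualGrothendieck.dualG K lam ⊥, hg⟩ :
            MvPowerSeries ℕ K) =
          ∑ nu ∈ Finset.Icc ⊥ lam with DualGrothendieck.IsVerticalStrip lam nu,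
            DualGrothendieck.stripCoeff t lam nu • DualGrothendieck.dualG K nu ⊥ ∧
        (DualGrothendieck.perp (DualGrothendieck.E t) ⟨DualGrothendieck.dualG K lam ⊥, hg⟩ :
            MvPowerSeries ℕ K) =
          DualGrothendieck.dualG K lam ⊥ +
            ∑ k ∈ Finset.Icc 1 (lam.colLen 0),
              (t * (t + 1) ^ (k - 1)) •
                DualGrothendieck.dualG K lam (DualGrothendieck.column k)) :=
  ⟨⟨DualGrothendieck.perpEquiv t, DualGrothendieck.perpEquiv_apply t⟩,
    fun _ _ h => ⟨DualGrothendieck.dualG_mem_symFun h, DualGrothendieck.coe_perp_E_dualG_left t h,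
      DualGrothendieck.coe_perp_E_dualG_right t h⟩,
    fun lam => ⟨DualGrothendieck.dualG_mem_symFun bot_le,
      DualGrothendieck.coe_perp_E_dualG_left t bot_le,
      DualGrothendieck.coe_perp_E_dualG_bot t lam⟩⟩
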